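/- Let $P=(X,\prec)$ be a finite poset with $|X|=n$ and let $t\in\mathbb N$. Let $\mathcal E(P)$ be the set of linear extensions of $P$, i.e. bijections $f:X\to[n]$ with $f(x)<f(y)$ whenever $x\prec y$, and let $e(P)=|\mathcal E(P)|$. Let $\mathbf\Omega(P,t)$ be the set of order preserving maps $g:X\to[t]$, i.e. maps with $g(x)\le g(y)$ whenever $x\prec y$, and let $\Omega(P,t)=|\mathbf\Omega(P,t)|$. Define $$\zeta(P,t)\;=\;\Omega(P,t)\,n!\;-\;e(P)\,t^n .$$ (a) The function $(P,t)\mapsto\zeta(P,t)$ is in $\#\mathrm P$, where the input is a poset on $\{1,\dots,n\}$ given by the matrix of its strict order, together with the number $t$ written in binary. That is, there are a finite alphabet $\Delta$ and a polynomially balanced relation between inputs and strings over $\Delta$, decidable by a Turing machine in polynomial time, such that $\zeta(P,t)$ is the number of strings related to $(P,t)$. (b) Write $X=\{x_1,\dots,x_n\}$, where $i<j$ whenever $x_i\prec x_j$. Define $\Psi:\mathcal E(P)\times[t]^n\to\mathbf\Omega(P,t)\times S_n$ as follows. View $\beta\in[t]^n$ as an ordered set partition $[n]=B_1\sqcup\dots\sqcup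 B_t$ (with $B_i$ possibly empty), and let $\alpha:[n]\to[t]$ be the weakly increasing sequence with $|B_i|$ copies of $i$ for each $i$. Put $\Psi(f,\beta)=(g,\sigma)$, where $g(x)=\alpha(f(x))$ and $\sigma=\gamma_1\gamma_2\cdots\gamma_t$ is the concatenation of the sequences $\gamma_i$ defined by: if $g^{-1}(i)=\{x_{i_1},\dots,x_{i_k}\}$ with $i_1<\dots<i_k$, then $\gamma_i$ is the rearrangement of $B_i$ whose entries are in the same relative order as $(f(x_{i_1}),\dots,f(x_{i_k}))$. Conversely, for $(g,\sigma)\in\mathbf\Omega(P,t)\times S_n$ put $c_i=|g^{-1}(i)|$, cut $\sigma$ into consecutive blocks of lengths $c_1,\dots,c_t$, let $C_i$ be the set of entries of the $i$-th block and $\pi=(C_1,\dots,C_t)$, and let $h:X\to[n]$ be the bijection which maps $g^{-1}(i)=\{x_{i_1},\dots,x_{i_k}\}$, $i_1<\dots<i_k$, onto $\{c_1+\dots+c_{i-1}+1,\dots,c_1+\dots+c_i\}$ so that $(h(x_{i_1}),\dots,h(x_{i_k}))$ is in the same relative order as the $i$-th block of $\sigma$. Then $\Psi$ is injective; for all $(f,\beta)\in\mathcal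 E(P)\times[t]^n$ and $(g,\sigma)\in\mathbf\Omega(P,t)\times S_n$ one has $\Psi(f,\beta)=(g,\sigma)$ if and only if $(h,\pi)=(f,\beta)$; and $\zeta(P,t)$ equals the number of pairs $(g,\sigma)\in\mathbf\Omega(P,t)\times S_n$ for which $h\notin\mathcal E(P)$. -/

import Mathlib

open Nat

namespace OrderPoly

/-! ### Linear extensions, order preserving maps and the function `ζ`

The sets `[n]` and `[t]` are modelled by `Fin n` and `Fin t` (values shifted by one). -/

/-- The set of linear extensions of `X`: bijections `f : X → [n]` with `f x < f y` for `x < y`. -/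
abbrev LinExt (X : Type*) [Fintype X] [PartialOrder X] : Type _ :=
  {f : X ≃ Fin (Fintype.card X) // StrictMono f}

/-- `e(P)`, the number of linear extensions. -/
noncomputable def numLinExt (X : Type*) [Fintype X] [PartialOrder X] : ℕ :=
  Nat.card (LinExt X)

/-- `Ω(P,t)`, the number of order preserving maps `X → [t]`. -/
noncomputable def orderPoly (X : Type*) [PartialOrder X] (t : ℕ) : ℕ :=
  Nat.card (X →o Fin t)

/-- `ζ(P,t) = Ω(P,t) n! - e(P) t^n`, as an integer. -/
noncomputable def zeta (X : Type*) [Fintype X] [PartialOrder X] (t : ℕ) : ℤ :=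
  (orderPoly X t : ℤ) * ((Fintype.card X)! : ℤ) - (numLinExt X : ℤ) * (t : ℤ) ^ Fintype.card X

/-! ### The map `Ψ` and its inverse

An ordered set partition `[n] = B_1 ⊔ … ⊔ B_t` (empty blocks allowed) is the map
`β : [n] → [t]` with `B_i = β⁻¹(i)`. The permutation `Tuple.sort β` of `[n]` is the stable sort
of `β`: its one-line notation lists `B_1` in increasing order, then `B_2` in increasing order,
and so on. In particular `β ∘ Tuple.sort β` is the weakly increasing rearrangement of `β`. -/

/-- The permutation of `[n]` listing the labels of the elements of `g⁻¹(1)` in increasing order,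
then those of `g⁻¹(2)` in increasing order, and so on. Here `ℓ` is the labelling of `X`. -/
noncomputable def blockOrder {X : Type*} [Fintype X] {t : ℕ} (ℓ : X ≃ Fin (Fintype.card X))
    (g : X → Fin t) : Equiv.Perm (Fin (Fintype.card X)) :=
  Tuple.sort (g ∘ ℓ.symm)

/-- The first component `g = α ∘ f` of `Ψ(f,β)`, where `α = (1,…,1,2,…,2,…,t,…,t)` has `|B_i|`
copies of `i`. -/
noncomputable def psiMap {X : Type*} [Fintype X] [PartialOrder X] {t : ℕ}
    (f : LinExt X) (β : Fin (Fintype.card X) → Fin t) : X →o Fin t where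
  toFun x := β (Tuple.sort β (f.1 x))
  monotone' _ _ hxy := Tuple.monotone_sort β (f.2.monotone hxy)

/-- The second component `σ` of `Ψ(f,β)`. If `x` is the element at position `p` of the list
`g⁻¹(1), g⁻¹(2), …` (each block in the order of the labels) and `g x = i`, then
`f x = |B_1| + … + |B_{i-1}| + s`, where `s` is the rank of `f x` among the values of `f` on
`g⁻¹(i)`, and `σ_p` is the `s`-th smallest element of `B_i`. Thus the block `γ_i` of `σ` is the
rearrangement of `B_i` with the same standardization as `f` on `g⁻¹(i)`. -/
noncomputable def psiPerm {X : Type*} [Fintype X] [PartialOrder X] {t : ℕ}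
    (ℓ : X ≃ Fin (Fintype.card X)) (f : LinExt X) (β : Fin (Fintype.card X) → Fin t) :
    Equiv.Perm (Fin (Fintype.card X)) :=
  (((blockOrder ℓ (psiMap f β)).trans ℓ.symm).trans f.1).trans (Tuple.sort β)

/-- The map `Ψ : E(P) × [t]^n → Ω(P,t) × S_n`. -/
noncomputable def psi {X : Type*} [Fintype X] [PartialOrder X] {t : ℕ}
    (ℓ : X ≃ Fin (Fintype.card X)) (q : LinExt X × (Fin (Fintype.card X) → Fin t)) :
    (X →o Fin t) × Equiv.Perm (Fin (Fintype.card X)) :=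
  (psiMap q.1 q.2, psiPerm ℓ q.1 q.2)

/-- The ordered set partition `π = (C_1,…,C_t)` in `Ψ⁻¹(g,σ) = (h,π)`: the block `C_i` consists
of the entries of `σ` at the positions `p` where the sorted sequence `τ` of the values of `g`
has `τ_p = i`. -/
noncomputable def psiInvPart {X : Type*} [Fintype X] {t : ℕ} (ℓ : X ≃ Fin (Fintype.card X))
    (g : X → Fin t) (σ : Equiv.Perm (Fin (Fintype.card X))) : Fin (Fintype.card X) → Fin t :=
  fun k => g (ℓ.symm (blockOrder ℓ g (σ.symm k)))

/-- The bijection `h : X → [n]` in `Ψ⁻¹(g,σ) = (h,π)`. If `x` is the element at position `p` of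
the list `g⁻¹(1), g⁻¹(2), …` (each block in the order of the labels) and `g x = i`, then
`h x = c_1 + … + c_{i-1} + s`, where `c_j = |g⁻¹(j)|` and `s` is the rank of `σ_p` in the block
`C_i`. It need not be a linear extension. -/
noncomputable def psiInvMap {X : Type*} [Fintype X] {t : ℕ} (ℓ : X ≃ Fin (Fintype.card X))
    (g : X → Fin t) (σ : Equiv.Perm (Fin (Fintype.card X))) : X ≃ Fin (Fintype.card X) :=
  ((ℓ.trans (blockOrder ℓ g).symm).trans σ).trans (Tuple.sort (psiInvPart ℓ g σ)).symm

/-! ### The class #P -/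

/-- The string encoding a pair of an instance and a certificate: the two strings are written one
after the other, over disjoint copies of their alphabets. -/
def encodePair {α Γ Δ : Type} (ea : α → List Γ) (q : α × List Δ) : List (Γ ⊕ Δ) :=
  (ea q.1).map Sum.inl ++ q.2.map Sum.inr

/-- The function `F`, on instances given as strings by `ea`, is in #P: there are a finite
alphabet `Δ` and a relation `R` between instances and strings over `Δ` (certificates) that is
decided by a Turing machine in polynomial time and is polynomially balanced, such that `F x` is
the number of strings `y` with `R x y`. -/
def InSharpP {α Γ : Type} (ea : α → List Γ) (F : α → ℤ) : Prop :=
  ∃ (Δ : Type) (_ : Fintype Δ) (R : α → List Δ → Bool) (p : Polynomial ℕ),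
    Nonempty (Turing.TM2ComputableInPolyTime (encodePair (Δ := Δ) ea) Computability.encodeBool
      (fun q => R q.1 q.2)) ∧
    (∀ x y, R x y = true → y.length ≤ p.eval (ea x).length) ∧
    ∀ x, F x = (Nat.card {y : List Δ // R x y = true} : ℤ)

/-! ### The inputs `(P,t)` -/

/-- An input `(P,t)`: a poset with elements `0, …, n-1`, given by the Boolean matrix of its strict
order, and a natural number `t`. -/
structure Input where
  /-- the number of elements -/
  n : ℕ
  /-- the strict order -/
  prec : Fin n → Fin n → Bool
  irrefl : ∀ i, ¬ prec i i = true
  trans : ∀ i j k, prec i j = true → prec j k = true → prec i k = true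
  /-- the second argument of `ζ` -/
  t : ℕ

/-- The ground set of the input poset (a copy of `Fin n`, not carrying its usual order). -/
def Input.Elem (I : Input) : Type := Fin I.n

instance (I : Input) : Fintype I.Elem := inferInstanceAs (Fintype (Fin I.n))

/-- The order of the input poset. -/
instance (I : Input) : PartialOrder I.Elem where
  le x y := x = y ∨ I.prec x y = true
  lt x y := I.prec x y = true
  le_refl _ := Or.inl rfl
  le_trans x y z := by
    rintro (rfl | h₁) (rfl | h₂)
    · exact Or.inl rfl
    · exact Or.inr h₂
    · exact Or.inr h₁
    · exact Or.inr (I.trans _ _ _ h₁ h₂)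
  lt_iff_le_not_ge x y := by
    constructor
    · intro h
      refine ⟨Or.inr h, ?_⟩
      rintro (rfl | h')
      · exact I.irrefl _ h
      · exact I.irrefl _ (I.trans _ _ _ h h')
    · rintro ⟨rfl | h, h'⟩
      · exact absurd (Or.inl rfl) h'
      · exact h
  le_antisymm x y := by
    rintro (rfl | h₁) (h | h₂)
    · rfl
    · rfl
    · exact h.symm
    · exact absurd (I.trans _ _ _ h₁ h₂) (I.irrefl _)

/-- The string of an input: the rows of the matrix of the strict order, each followed by the
separator `none`, and then `t` in binary. -/
def Input.encode (I : Input) : List (Option Bool) :=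
  (List.finRange I.n).flatMap
    (fun i => (List.finRange I.n).map (fun j => some (I.prec i j)) ++ [none]) ++
  (Computability.encodeNat I.t).map some

end OrderPoly

namespace OrderPoly

/-! For a pair `(g, σ)` let `s x` be the entry of `σ` at the position of `x` in the block order of
`g`. For fixed `g`, passing from `σ` to `s` is a bijection onto the bijections `X → [n]`. In these
coordinates `Ψ(f, β) = (g, σ)` reads `s = sort β ∘ f` and `g = β ∘ s`. Solving for `β` and `f` gives
`β = g ∘ s⁻¹` and `f = (sort β)⁻¹ ∘ s`, which are `π` and `h` (`psi_eq_iff`). Hence `Ψ` is injective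
and its image consists of the pairs for which `h` is a linear extension, so `ζ` counts the remaining
pairs (`zeta_eq_card`).

Since the sort is stable, `h` ranks `X` by the lexicographic order of `(g x, s x)`. So `h` fails to
be a linear extension exactly when some `x < y` have `g x = g y` and `s y < s x`. Thus `ζ` counts
the pairs `(g, s)` with such an inversion (`zeta_eq_card_inversions`), a description free of
labellings and sorting.

For membership in #P, a certificate lists one record per element: `g x` in binary, in as many digits
as `t` has, then `s x` in unary padded to length `n`. All records have the same length, so each pair
has exactly one certificate (`encodeCert_injective`). The verifier checks the format and then
compares all pairs of records: `g` must be order preserving, `s` injective, and an inversion must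
occur (`finalFlags_iff`).

The machine is obtained from a small structured language with a cost semantics. `Run.reachIn` turns
a derivation of cost `t` into at most `t` machine steps, and `run_verifier` gives a cubic bound for
the cost of the verifier. -/

/-! ### A structured language of stack programs -/

/-- The instructions of stack programs: `V` is the type of the internal state, `K` indexes the
stacks. -/
inductive Instr (K V Γ : Type)
  | push (k : K) (f : V → Γ)
  | pop (k : K) (f : V → Option Γ → V)
  | load (f : V → V)

/-- Structured stack programs. The condition of a loop may look at the top of one stack. -/
inductive Prog (K V Γ : Type)
  | block (l : List (Instr K V Γ))
  | seq (p q : Prog K V Γ)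
  | ite (c : V → Bool) (p q : Prog K V Γ)
  | loop (k : K) (c : Option Γ → Bool) (p : Prog K V Γ)

section Semantics

variable {K V Γ : Type} [DecidableEq K]

/-- The effect of an instruction. -/
def Instr.eff : Instr K V Γ → V × (K → List Γ) → V × (K → List Γ)
  | .push k f, s => (s.1, Function.update s.2 k (f s.1 :: s.2 k))
  | .pop k f, s => (f s.1 (s.2 k).head?, Function.update s.2 k (s.2 k).tail)
  | .load f, s => (f s.1, s.2)

/-- The effect of a list of instructions. -/
def effs : List (Instr K V Γ) → V × (K → List Γ) → V × (K → List Γ)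
  | [], s => s
  | i :: l, s => effs l (i.eff s)

/-- `Run p s s' t`: started in `s`, the program `p` ends in `s'`, at a cost of at most `t`. -/
inductive Run : Prog K V Γ → V × (K → List Γ) → V × (K → List Γ) → ℕ → Prop
  | block {l s s' t} : effs l s = s' → l.length + 1 ≤ t → Run (.block l) s s' t
  | seq {p q s s₁ s₂ t₁ t₂ t} : Run p s s₁ t₁ → Run q s₁ s₂ t₂ → t₁ + t₂ ≤ t →
      Run (.seq p q) s s₂ t
  | ite_true {c p q s s' t₁ t} : c s.1 = true → Run p s s' t₁ → t₁ + 1 ≤ t →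
      Run (.ite c p q) s s' t
  | ite_false {c p q s s' t₁ t} : c s.1 = false → Run q s s' t₁ → t₁ + 1 ≤ t →
      Run (.ite c p q) s s' t
  | loop_true {k c p s s₁ s₂ t₁ t₂ t} : c (s.2 k).head? = true → Run p s s₁ t₁ →
      Run (.loop k c p) s₁ s₂ t₂ → t₁ + t₂ + 1 ≤ t → Run (.loop k c p) s s₂ t
  | loop_false {k c p s t} : c (s.2 k).head? = false → 1 ≤ t → Run (.loop k c p) s s t

theorem Run.mono {p : Prog K V Γ} {s s' t t'} (h : Run p s s' t) (ht : t ≤ t') :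
    Run p s s' t' := by
  cases h with
  | block h₁ h₂ => exact .block h₁ (h₂.trans ht)
  | seq h₁ h₂ h₃ => exact .seq h₁ h₂ (h₃.trans ht)
  | ite_true h₁ h₂ h₃ => exact .ite_true h₁ h₂ (h₃.trans ht)
  | ite_false h₁ h₂ h₃ => exact .ite_false h₁ h₂ (h₃.trans ht)
  | loop_true h₁ h₂ h₃ h₄ => exact .loop_true h₁ h₂ h₃ (h₄.trans ht)
  | loop_false h₁ h₂ => exact .loop_false h₁ (h₂.trans ht)

/-- The total length of the stacks. -/
def size [Fintype K] (S : K → List Γ) : ℕ := ∑ k, (S k).length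

theorem size_update [Fintype K] (S : K → List Γ) (k : K) (l : List Γ) :
    size (Function.update S k l) + (S k).length = size S + l.length := by
  have h₁ := Finset.sum_update_of_mem (Finset.mem_univ k) (fun k => (S k).length) l.length
  have h₂ := Finset.add_sum_erase Finset.univ (fun k => (S k).length) (Finset.mem_univ k)
  have h₃ : size (Function.update S k l)
      = ∑ x, Function.update (fun k => (S k).length) k l.length x := by
    refine Finset.sum_congr rfl fun x _ => ?_
    by_cases h : x = k
    · subst h; simp
    · simp [h]
  rw [Finset.sdiff_singleton_eq_erase] at h₁
  simp only [size] at *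
  omega

theorem size_eff [Fintype K] (i : Instr K V Γ) (s : V × (K → List Γ)) :
    size (i.eff s).2 ≤ size s.2 + 1 := by
  cases i with
  | push k f => have := size_update s.2 k (f s.1 :: s.2 k); simp [Instr.eff] at *; omega
  | pop k f => have := size_update s.2 k (s.2 k).tail; simp [Instr.eff] at *; omega
  | load f => simp [Instr.eff]

theorem size_effs [Fintype K] (l : List (Instr K V Γ)) (s : V × (K → List Γ)) :
    size (effs l s).2 ≤ size s.2 + l.length := by
  induction l generalizing s with
  | nil => simp [effs]
  | cons i l ih =>
    have := ih (i.eff s)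
    have := size_eff i s
    simp only [effs, List.length_cons]
    omega

/-- A block is a single machine step, but its cost also counts its instructions. Each instruction
adds at most one symbol, so the cost bounds the growth of the stacks as well; this is needed to
bound the time for emptying them. -/
theorem Run.size_le [Fintype K] {p : Prog K V Γ} {s s' t} (h : Run p s s' t) :
    size s'.2 ≤ size s.2 + t := by
  induction h with
  | block h₁ h₂ => subst h₁; have := size_effs ‹_› ‹_›; omega
  | _ => omega

/-- Empty a list of stacks. -/
def clearAll : List K → Prog K V Γ
  | [] => .block []
  | k :: l => .seq (.loop k Option.isSome (.block [.pop k fun v _ => v])) (clearAll l)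

theorem run_clear (k : K) (v : V) (S : K → List Γ) (l : List Γ) :
    Run (.loop k Option.isSome (.block [.pop k fun v _ => v])) (v, Function.update S k l)
      (v, Function.update S k []) (3 * l.length + 1) := by
  induction l with
  | nil => exact .loop_false (by simp) (by simp)
  | cons a l ih =>
    refine .loop_true (by simp) (.block rfl le_rfl) ?_ (t₂ := 3 * l.length + 1) (by simp; omega)
    simpa [effs, Instr.eff] using ih

theorem run_clearAll [Fintype K] (l : List K) (v : V) (S : K → List Γ) :
    Run (clearAll l) (v, S) (v, fun k => if k ∈ l then [] else S k)
      (l.length * (3 * size S + 1) + 1) := by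
  induction l generalizing S with
  | nil => exact .block (by simp [effs]) (by simp)
  | cons a l ih =>
    have h := run_clear a v S (S a)
    rw [Function.update_eq_self] at h
    have hs := size_update S a []
    have ha : (S a).length ≤ size S :=
      Finset.single_le_sum (f := fun k => (S k).length) (fun _ _ => Nat.zero_le _)
        (Finset.mem_univ a)
    refine .seq h (s₂ := _) (t₂ := l.length * (3 * size S + 1) + 1) ?_ ?_
    · have h₂ := (ih (Function.update S a [])).mono
        (t' := l.length * (3 * size S + 1) + 1) (by simp at hs; gcongr; omega)
      convert h₂ using 3 with k
      by_cases hk : k = a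
      · subst hk; simp
      · simp [hk]
    · simp only [List.length_cons]
      nlinarith

end Semantics

/-! ### Translation of stack programs into Turing machines -/

section Compile

variable {K V Γ : Type}

/-- The labels of the machine of a program. -/
def Prog.Lab : Prog K V Γ → Type
  | .block _ => Unit
  | .seq p q => p.Lab ⊕ q.Lab
  | .ite _ p q => Option (p.Lab ⊕ q.Lab)
  | .loop _ _ p => Option p.Lab

/-- The label at which a program starts. -/
def Prog.entry : (p : Prog K V Γ) → p.Lab
  | .block _ => ()
  | .seq p _ => Sum.inl p.entry
  | .ite _ _ _ => none
  | .loop _ _ _ => none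

theorem Prog.finite_lab : (p : Prog K V Γ) → Finite p.Lab
  | .block _ => inferInstanceAs (Finite Unit)
  | .seq p q =>
    have := p.finite_lab
    have := q.finite_lab
    inferInstanceAs (Finite (p.Lab ⊕ q.Lab))
  | .ite _ p q =>
    have := p.finite_lab
    have := q.finite_lab
    inferInstanceAs (Finite (Option (p.Lab ⊕ q.Lab)))
  | .loop _ _ p =>
    have := p.finite_lab
    inferInstanceAs (Finite (Option p.Lab))

/-- The stack alphabets of the machine: one additional stack takes the Boolean output. -/
abbrev StackAlphabet (K Γ : Type) : Option K → Type
  | none => Bool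
  | some _ => Γ

/-- The statements of the machine. The additional Boolean in the internal state is used for the
conditions of loops. -/
abbrev MStmt (K V Γ Λ : Type) := Turing.TM2.Stmt (StackAlphabet K Γ) Λ (V × Bool)

/-- The statement for an instruction. -/
def Instr.code {Λ : Type} : Instr K V Γ → MStmt K V Γ Λ → MStmt K V Γ Λ
  | .push k f, q => .push (some k) (fun v => f v.1) q
  | .pop k f, q => .pop (some k) (fun v o => (f v.1 o, v.2)) q
  | .load f, q => .load (fun v => (f v.1, v.2)) q

/-- The statements at the labels of a program, which jumps to `exit` when it has ended. -/
def Prog.code {Λ : Type} : (p : Prog K V Γ) → (p.Lab → Λ) → Λ → p.Lab → MStmt K V Γ Λ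
  | .block l, _, exit, _ => l.foldr Instr.code (.goto fun _ => exit)
  | .seq p q, emb, exit, x =>
    match x with
    | Sum.inl x => p.code (fun x => emb (Sum.inl x)) (emb (Sum.inr q.entry)) x
    | Sum.inr x => q.code (fun x => emb (Sum.inr x)) exit x
  | .ite c p q, emb, exit, x =>
    match x with
    | none => .branch (fun v => c v.1) (.goto fun _ => emb (some (Sum.inl p.entry)))
        (.goto fun _ => emb (some (Sum.inr q.entry)))
    | some (Sum.inl x) => p.code (fun x => emb (some (Sum.inl x))) exit x
    | some (Sum.inr x) => q.code (fun x => emb (some (Sum.inr x))) exit x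
  | .loop k c p, emb, exit, x =>
    match x with
    | none => .peek (some k) (fun v o => (v.1, c o)) <| .branch (fun v => v.2)
        (.load (fun v => (v.1, false)) <| .goto fun _ => emb (some p.entry))
        (.load (fun v => (v.1, false)) <| .goto fun _ => exit)
    | some x => p.code (fun x => emb (some x)) (emb none) x

/-- The stacks of the machine, with empty output. -/
def embStk (S : K → List Γ) : (k : Option K) → List (StackAlphabet K Γ k)
  | none => []
  | some k => S k

variable [DecidableEq K]

theorem update_embStk (S : K → List Γ) (k : K) (l : List Γ) :
    Function.update (embStk S) (some k) l = embStk (Function.update S k l) := by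
  funext x
  cases x with
  | none => rfl
  | some x =>
    by_cases h : x = k
    · subst h; simp [embStk]
    · simp [embStk, h]

/-- `ReachIn M c c' t`: the machine `M` gets from `c` to `c'` in at most `t` steps. -/
def ReachIn {K : Type} [DecidableEq K] {Γ : K → Type} {Λ σ : Type}
    (M : Λ → Turing.TM2.Stmt Γ Λ σ) (c c' : Turing.TM2.Cfg Γ Λ σ) (t : ℕ) : Prop :=
  Nonempty (StateTransition.EvalsToInTime (Turing.TM2.step M) c (some c') t)

theorem ReachIn.trans {K : Type} [DecidableEq K] {Γ : K → Type} {Λ σ : Type}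
    {M : Λ → Turing.TM2.Stmt Γ Λ σ} {c c' c'' : Turing.TM2.Cfg Γ Λ σ} {t₁ t₂ t : ℕ}
    (h₁ : ReachIn M c c' t₁) (h₂ : ReachIn M c' c'' t₂) (ht : t₁ + t₂ ≤ t) :
    ReachIn M c c'' t := by
  obtain ⟨h₁⟩ := h₁
  obtain ⟨h₂⟩ := h₂
  have h := StateTransition.EvalsToInTime.trans _ _ _ _ _ _ h₁ h₂
  exact ⟨⟨h.toEvalsTo, h.steps_le_m.trans (by omega)⟩⟩

theorem ReachIn.step {K : Type} [DecidableEq K] {Γ : K → Type} {Λ σ : Type}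
    {M : Λ → Turing.TM2.Stmt Γ Λ σ} {c c' : Turing.TM2.Cfg Γ Λ σ} {t : ℕ}
    (h : Turing.TM2.step M c = some c') (ht : 1 ≤ t) : ReachIn M c c' t :=
  ⟨⟨⟨1, by simpa [flip] using h⟩, ht⟩⟩

theorem stepAux_instrs {Λ : Type} (l : List (Instr K V Γ)) (exit : Λ) (s : V × (K → List Γ)) :
    Turing.TM2.stepAux (l.foldr Instr.code (.goto fun _ => exit)) (s.1, false) (embStk s.2)
      = ⟨some exit, ((effs l s).1, false), embStk (effs l s).2⟩ := by
  induction l generalizing s with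
  | nil => rfl
  | cons i l ih =>
    cases i with
    | push k f =>
      simp only [List.foldr_cons, Instr.code, Turing.TM2.stepAux, effs, Instr.eff]
      rw [update_embStk]
      exact ih (s.1, Function.update s.2 k (f s.1 :: s.2 k))
    | pop k f =>
      simp only [List.foldr_cons, Instr.code, Turing.TM2.stepAux, effs, Instr.eff]
      rw [update_embStk]
      exact ih (f s.1 (s.2 k).head?, Function.update s.2 k (s.2 k).tail)
    | load f =>
      simp only [List.foldr_cons, Instr.code, Turing.TM2.stepAux, effs, Instr.eff]
      exact ih (_, s.2)

/-- Induction on the derivation. The embedding of labels and the exit label vary because a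
subprogram sits inside the labels of the whole and exits to its successor or back to the loop head.
The auxiliary Boolean is `false` at every junction, since loops reset it after their test. -/
theorem Run.reachIn {p : Prog K V Γ} {s s' t} (h : Run p s s' t) {Λ : Type}
    (M : Λ → MStmt K V Γ Λ) (emb : p.Lab → Λ) (exit : Λ)
    (hM : ∀ x, M (emb x) = p.code emb exit x) :
    ReachIn M ⟨some (emb p.entry), (s.1, false), embStk s.2⟩
      ⟨some exit, (s'.1, false), embStk s'.2⟩ t := by
  induction h generalizing exit with
  | @block l s s' t h₁ h₂ =>
    subst h₁
    refine .step ?_ (by omega : 1 ≤ t)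
    rw [Turing.TM2.step, hM]
    exact congrArg some (stepAux_instrs l exit s)
  | @seq p q _ _ _ _ _ _ _ _ ht ih₁ ih₂ =>
    exact (ih₁ (fun x => emb (Sum.inl x)) (emb (Sum.inr q.entry)) fun x => hM (Sum.inl x)).trans
      (ih₂ (fun x => emb (Sum.inr x)) exit fun x => hM (Sum.inr x)) ht
  | @ite_true c p q s s' t₁ t hc _ ht ih =>
    refine ReachIn.trans (.step ?_ le_rfl)
      (ih (fun x => emb (some (Sum.inl x))) exit fun x => hM (some (Sum.inl x))) (by omega)
    rw [Turing.TM2.step]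
    erw [hM none]
    simp [Prog.code, hc]
  | @ite_false c p q s s' t₁ t hc _ ht ih =>
    refine ReachIn.trans (.step ?_ le_rfl)
      (ih (fun x => emb (some (Sum.inr x))) exit fun x => hM (some (Sum.inr x))) (by omega)
    rw [Turing.TM2.step]
    erw [hM none]
    simp [Prog.code, hc]
  | @loop_true k c p s _ _ _ _ _ hc _ _ ht ih₁ ih₂ =>
    refine ReachIn.trans (.step ?_ le_rfl)
      (ReachIn.trans (ih₁ (fun x => emb (some x)) (emb none) fun x => hM (some x))
        (ih₂ emb exit hM) le_rfl) (by omega)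
    rw [Turing.TM2.step]
    erw [hM none]
    simp only [Prog.code, Turing.TM2.stepAux]
    rw [show c (embStk s.2 (some k)).head? = true from hc]
    rfl
  | @loop_false k c p s t hc ht =>
    refine .step ?_ ht
    rw [Turing.TM2.step]
    erw [hM none]
    simp only [Prog.code, Turing.TM2.stepAux]
    rw [show c (embStk s.2 (some k)).head? = false from hc]
    rfl

/-- The machine of a program with input stack `k₀` and initial state `v₀`, which at the end writes
`out v` on the output stack, where `v` is the final state of the program. -/
noncomputable def Prog.machine [Fintype K] [Fintype V] [Fintype Γ] (p : Prog K V Γ) (k₀ : K)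
    (v₀ : V) (out : V → Bool) : Turing.FinTM2 where
  K := Option K
  k₀ := some k₀
  k₁ := none
  Γ := StackAlphabet K Γ
  Λ := Option p.Lab
  main := some p.entry
  ΛFin := by
    have := p.finite_lab
    exact Fintype.ofFinite _
  σ := V × Bool
  initialState := (v₀, false)
  Γk₀Fin := inferInstanceAs (Fintype Γ)
  m
    | none => .push none (fun v => out v.1) <| .load (fun _ => (v₀, false)) .halt
    | some x => p.code some none x

/-- The exit label `none` writes the output and restores the initial state, as the halting
configuration `haltList` demands. This is the one additional step in `time + 1`. -/
theorem computable_of_run_empty [Fintype K] [Fintype V] [Fintype Γ] {α : Type} (ea : α → List Γ)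
    (F : α → Bool) (p : Prog K V Γ) (k₀ : K) (v₀ : V) (out : V → Bool) (time : Polynomial ℕ)
    (h : ∀ a, ∃ v, Run p (v₀, Function.update (fun _ => []) k₀ (ea a)) (v, fun _ => [])
      (time.eval (ea a).length) ∧ out v = F a) :
    Nonempty (Turing.TM2ComputableInPolyTime ea Computability.encodeBool F) := by
  refine ⟨⟨⟨p.machine k₀ v₀ out, Equiv.refl _, Equiv.refl _⟩, time + 1, fun a => ?_⟩⟩
  refine Nonempty.some ?_
  obtain ⟨v, hrun, hv⟩ := h a
  have h₁ := hrun.reachIn (p.machine k₀ v₀ out).m some none fun x => rfl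
  have h₂ : ReachIn (p.machine k₀ v₀ out).m
      ⟨some none, (v, false), embStk (fun _ => [])⟩
      (Turing.haltList (p.machine k₀ v₀ out) [F a]) 1 := by
    refine .step (congrArg some ?_) le_rfl
    simp only [Prog.machine, Turing.TM2.stepAux, Turing.haltList, hv, Turing.TM2.Cfg.mk.injEq,
      true_and]
    funext k
    cases k with
    | none => rfl
    | some k => rfl
  have h₃ := h₁.trans h₂ (t := (time + 1).eval (ea a).length) (by simp)
  have h₄ : (⟨some (some p.entry), (v₀, false),
      embStk (Function.update (fun _ => []) k₀ (ea a))⟩ :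
      Turing.TM2.Cfg (StackAlphabet K Γ) (Option p.Lab) (V × Bool))
      = Turing.initList (p.machine k₀ v₀ out) (ea a) := by
    simp only [Turing.initList, Prog.machine, Turing.TM2.Cfg.mk.injEq, true_and]
    funext k
    cases k with
    | none => rfl
    | some k =>
      by_cases hk : k = k₀
      · subst hk
        simp [embStk]
        rfl
      · simp [embStk, hk]
  simp only at h₃
  erw [h₄] at h₃
  have hmap : List.map (Equiv.refl ((p.machine k₀ v₀ out).Γ (p.machine k₀ v₀ out).k₀)).invFun
      (ea a) = ea a := List.map_id _
  simp only [Turing.TM2OutputsInTime]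
  erw [hmap]
  exact h₃

/-- A halting configuration must have empty work stacks, so the program is followed by `clearAll`.
Its cost is polynomial because the final stacks hold at most input length plus running time many
symbols. -/
theorem computable_of_run [Fintype K] [Fintype V] [Fintype Γ] {α : Type} (ea : α → List Γ)
    (F : α → Bool) (p : Prog K V Γ) (k₀ : K) (v₀ : V) (out : V → Bool) (time : Polynomial ℕ)
    (h : ∀ a, ∃ s, Run p (v₀, Function.update (fun _ => []) k₀ (ea a)) s
      (time.eval (ea a).length) ∧ out s.1 = F a) :
    Nonempty (Turing.TM2ComputableInPolyTime ea Computability.encodeBool F) := by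
  refine computable_of_run_empty ea F (.seq p (clearAll Finset.univ.toList)) k₀ v₀ out
    (time + (Polynomial.C (Fintype.card K) * (3 * (Polynomial.X + time) + 1) + 1)) fun a => ?_
  obtain ⟨⟨v, S⟩, hrun, hv⟩ := h a
  refine ⟨v, .seq hrun (t₂ := Fintype.card K *
    (3 * ((ea a).length + time.eval (ea a).length) + 1) + 1) ?_ ?_, hv⟩
  · have h₁ := run_clearAll Finset.univ.toList v S
    simp only [Finset.mem_toList, Finset.mem_univ, if_true, Finset.length_toList] at h₁
    refine h₁.mono ?_
    have h₂ := hrun.size_le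
    have h₃ := size_update (fun _ : K => ([] : List Γ)) k₀ (ea a)
    simp only [size, List.length_nil, Finset.sum_const_zero] at h₂ h₃
    rw [Finset.card_univ]
    gcongr
    simp only [size]
    omega
  · simp

end Compile

/-! ### The verifier -/

/-- The alphabet of the verifier. -/
abbrev Sym := Option Bool ⊕ Bool

/-- The stacks of the verifier. -/
inductive Stk
  | inp | mat | ref | ref' | cnt | c1 | c2 | c2' | acc | acc'
  deriving DecidableEq

instance : Fintype Stk :=
  ⟨{.inp, .mat, .ref, .ref', .cnt, .c1, .c2, .c2', .acc, .acc'}, by rintro ⟨⟩ <;> decide⟩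

/-- The flags of the verifier. -/
structure Flags where
  /-- comparison of the values of `g` -/
  cg : Ordering
  /-- comparison of the values of `s` -/
  cs : Ordering
  /-- a zero has been read in the unary part of a record -/
  z : Bool
  /-- the certificate is to be rejected -/
  bad : Bool
  /-- an inversion has been found -/
  found : Bool
  /-- an equal value of `s` has been found in the current row -/
  seen : Bool
  /-- the current entry of the matrix -/
  bit : Bool

/-- The internal state of the verifier: two registers and the flags. -/
structure Vars where
  /-- first register -/
  r : Sym
  /-- second register -/
  d : Sym
  /-- the flags -/
  f : Flags

noncomputable instance : Fintype Flags :=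
  Fintype.ofInjective (fun f : Flags => (f.cg, f.cs, f.z, f.bad, f.found, f.seen, f.bit)) (by
    rintro ⟨⟩ ⟨⟩ h
    simpa using h)

noncomputable instance : Fintype Vars :=
  Fintype.ofInjective (fun v : Vars => (v.r, v.d, v.f)) (by
    rintro ⟨⟩ ⟨⟩ h
    simpa using h)

/-- The initial flags. -/
def Flags.init : Flags := ⟨.eq, .eq, false, false, false, false, false⟩

/-- The state with given flags and default registers. -/
def Vars.ofFlags (f : Flags) : Vars := ⟨.inr false, .inr false, f⟩

/-- Pop into the first register. -/
def popR (k : Stk) : Instr Stk Vars Sym := .pop k fun v o => { v with r := o.getD (.inr false) }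

/-- Pop into the second register. -/
def popD (k : Stk) : Instr Stk Vars Sym := .pop k fun v o => { v with d := o.getD (.inr false) }

/-- Push the first register. -/
def pushR (k : Stk) : Instr Stk Vars Sym := .push k Vars.r

/-- Push the second register. -/
def pushD (k : Stk) : Instr Stk Vars Sym := .push k Vars.d

/-- Reset the registers. -/
def resetRegs : Instr Stk Vars Sym := .load fun v => .ofFlags v.f

/-- Whether a symbol is a binary digit of the input. -/
def isDigit : Option Sym → Bool
  | some (.inl (some _)) => true
  | _ => false

/-- Whether a symbol belongs to the input. -/
def isInput : Option Sym → Bool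
  | some (.inl _) => true
  | _ => false

/-- Move the contents of a stack to another stack, in reverse order. -/
def move (a b : Stk) : Prog Stk Vars Sym :=
  .loop a Option.isSome (.block [popD a, pushD b, resetRegs])

/-- Move the instance to `mat`, in reverse order, and put a one on `ref` and `cnt` for each row. -/
def readInput : Prog Stk Vars Sym :=
  .loop .inp isInput <| .seq (.block [popD .inp]) <| .seq
    (.ite (fun v => v.d = .inl none)
      (.block [.push .ref fun _ => .inr true, .push .cnt fun _ => .inr true]) (.block []))
    (.block [pushD .mat, resetRegs])

/-- Move the digits of `t` to `ref`. -/
def readBound : Prog Stk Vars Sym :=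
  .loop .mat isDigit (.block [popD .mat, pushD .ref, resetRegs])

/-- The bit of a symbol of the certificate. -/
def digit : Option Sym → Bool
  | some (.inr b) => b
  | _ => false

/-- The symbol with bit `b` of the same kind as `r`. -/
def retag (r : Sym) (b : Bool) : Sym := Sum.elim (fun _ => .inl (some b)) (fun _ => .inr b) r

/-- Check one symbol of the certificate against the reference record. -/
def Flags.check (r : Sym) (o : Option Sym) (f : Flags) : Flags :=
  match r with
  | .inl x => { f with
      bad := f.bad || o.isNone
      cg := (compare (digit o) (x.getD false)).then f.cg }
  | .inr _ => { f with
      bad := f.bad || o.isNone || (f.z && digit o)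
      z := f.z || !digit o }

/-- The check at the end of a record. -/
def Flags.endRecord (f : Flags) : Flags :=
  { f with
    bad := f.bad || decide (f.cg ≠ .lt) || !f.z
    cg := .eq
    z := false }

/-- Read one record of the certificate and check it. -/
def readRecord : Prog Stk Vars Sym :=
  .loop .ref Option.isSome <| .block [popR .ref, pushR .ref',
    .pop .inp fun v o => ⟨v.r, retag v.r (digit o), v.f.check v.r o⟩,
    pushD .c1, pushD .c2, resetRegs]

/-- Read the certificate and check its format. -/
def readCertificate : Prog Stk Vars Sym :=
  .seq
    (.loop .cnt Option.isSome <| .seq (.block [popD .cnt, resetRegs]) <| .seq readRecord <|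
      .seq (.block [.load fun v => { v with f := v.f.endRecord }]) (move .ref' .ref))
    (.block [.pop .inp fun v o => { v with f := { v.f with bad := v.f.bad || o.isSome } }])

/-- Load the current record. -/
def loadRecord : Prog Stk Vars Sym :=
  .seq (.loop .ref Option.isSome
      (.block [popR .ref, pushR .ref', popD .c1, pushD .acc', resetRegs])) <|
    .seq (move .acc' .acc) (move .ref' .ref)

/-- Compare two symbols. -/
def Flags.compare (r d : Sym) (f : Flags) : Flags :=
  match r, d with
  | .inl (some x), .inl (some y) => { f with cg := f.cg.then (Ord.compare x y) }
  | .inr x, .inr y => { f with cs := f.cs.then (Ord.compare x y) }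
  | _, _ => f

/-- The flags before the comparison of two records, given the entry of the matrix. -/
def Flags.startPair (f : Flags) (b : Bool) : Flags :=
  { f with cg := .eq, cs := .eq, bit := b }

/-- The flags after the comparison of two records. -/
def Flags.endPair (f : Flags) : Flags :=
  { f with
    bad := f.bad || (f.bit && decide (f.cg = .gt)) || (f.seen && decide (f.cs = .eq))
    seen := f.seen || decide (f.cs = .eq)
    found := f.found || (f.bit && decide (f.cg = .eq) && decide (f.cs = .gt)) }

/-- Compare the current record with the next record. -/
def comparePair : Prog Stk Vars Sym :=
  .seq (.block [.pop .mat fun v o => { v with f := v.f.startPair (decide (o = some (.inl (some true)))) }])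
    <| .seq (.loop .acc Option.isSome (.block [popR .acc, pushR .acc', popD .c2, pushD .c2',
        .load fun v => { v with f := v.f.compare v.r v.d }, resetRegs])) <|
      .seq (move .acc' .acc) (.block [.load fun v => { v with f := v.f.endPair }])

/-- Compare a record with all records. -/
def compareRow : Prog Stk Vars Sym :=
  .seq (.block [.pop .mat fun v _ => { v with f := { v.f with seen := false } }]) <|
    .seq loadRecord <| .seq (.loop .mat isDigit comparePair) <|
      .seq (move .c2' .c2) (.loop .acc Option.isSome (.block [popD .acc, resetRegs]))

/-- The verifier. -/
def verifier : Prog Stk Vars Sym :=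
  .seq readInput <| .seq readBound <| .seq readCertificate (.loop .mat Option.isSome compareRow)

/-! ### Correctness of the verifier -/

/-- The stacks with given contents. -/
def stk (inp mat ref ref' cnt c1 c2 c2' acc acc' : List Sym) : Stk → List Sym
  | .inp => inp | .mat => mat | .ref => ref | .ref' => ref' | .cnt => cnt | .c1 => c1 | .c2 => c2
  | .c2' => c2' | .acc => acc | .acc' => acc'

section

variable (inp mat ref ref' cnt c1 c2 c2' acc acc' l : List Sym)

local notation "st" => stk inp mat ref ref' cnt c1 c2 c2' acc acc'

@[simp] theorem update_inp :
    Function.update st .inp l = stk l mat ref ref' cnt c1 c2 c2' acc acc' := by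
  funext k; cases k <;> rfl
@[simp] theorem update_mat :
    Function.update st .mat l = stk inp l ref ref' cnt c1 c2 c2' acc acc' := by
  funext k; cases k <;> rfl
@[simp] theorem update_ref :
    Function.update st .ref l = stk inp mat l ref' cnt c1 c2 c2' acc acc' := by
  funext k; cases k <;> rfl
@[simp] theorem update_ref' :
    Function.update st .ref' l = stk inp mat ref l cnt c1 c2 c2' acc acc' := by
  funext k; cases k <;> rfl
@[simp] theorem update_cnt :
    Function.update st .cnt l = stk inp mat ref ref' l c1 c2 c2' acc acc' := by
  funext k; cases k <;> rfl
@[simp] theorem update_c1 :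
    Function.update st .c1 l = stk inp mat ref ref' cnt l c2 c2' acc acc' := by
  funext k; cases k <;> rfl
@[simp] theorem update_c2 :
    Function.update st .c2 l = stk inp mat ref ref' cnt c1 l c2' acc acc' := by
  funext k; cases k <;> rfl
@[simp] theorem update_c2' :
    Function.update st .c2' l = stk inp mat ref ref' cnt c1 c2 l acc acc' := by
  funext k; cases k <;> rfl
@[simp] theorem update_acc :
    Function.update st .acc l = stk inp mat ref ref' cnt c1 c2 c2' l acc' := by
  funext k; cases k <;> rfl
@[simp] theorem update_acc' :
    Function.update st .acc' l = stk inp mat ref ref' cnt c1 c2 c2' acc l := by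
  funext k; cases k <;> rfl

end

@[simp] theorem eff_push (k : Stk) (f : Vars → Sym) (s : Vars × (Stk → List Sym)) :
    (Instr.push k f).eff s = (s.1, Function.update s.2 k (f s.1 :: s.2 k)) := rfl
@[simp] theorem eff_pop (k : Stk) (f : Vars → Option Sym → Vars) (s : Vars × (Stk → List Sym)) :
    (Instr.pop k f).eff s = (f s.1 (s.2 k).head?, Function.update s.2 k (s.2 k).tail) := rfl
@[simp] theorem eff_load (f : Vars → Vars) (s : Vars × (Stk → List Sym)) :
    (Instr.load f).eff s = (f s.1, s.2) := rfl
@[simp] theorem eff_popR (k : Stk) (s : Vars × (Stk → List Sym)) : (popR k).eff s =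
    ({ s.1 with r := (s.2 k).head?.getD (.inr false) }, Function.update s.2 k (s.2 k).tail) := rfl
@[simp] theorem eff_popD (k : Stk) (s : Vars × (Stk → List Sym)) : (popD k).eff s =
    ({ s.1 with d := (s.2 k).head?.getD (.inr false) }, Function.update s.2 k (s.2 k).tail) := rfl
@[simp] theorem eff_pushR (k : Stk) (s : Vars × (Stk → List Sym)) : (pushR k).eff s =
    (s.1, Function.update s.2 k (s.1.r :: s.2 k)) := rfl
@[simp] theorem eff_pushD (k : Stk) (s : Vars × (Stk → List Sym)) : (pushD k).eff s =
    (s.1, Function.update s.2 k (s.1.d :: s.2 k)) := rfl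
@[simp] theorem eff_resetRegs (s : Vars × (Stk → List Sym)) : resetRegs.eff s =
    (.ofFlags s.1.f, s.2) := rfl

@[simp] theorem digit_none : digit none = false := rfl
@[simp] theorem digit_some (b : Bool) : digit (some (.inr b)) = b := rfl

/-! ### Effect and cost of the phases of the verifier -/

theorem Run.congr {K V Γ : Type} [DecidableEq K] {p : Prog K V Γ} {s₀ s s' s'' t t'}
    (h : Run p s s' t) (h₀ : s₀ = s) (hs : s' = s'') (ht : t ≤ t') : Run p s₀ s'' t' := by
  subst hs h₀
  exact h.mono ht

/-- Each round costs one for the test and four for the block of three instructions, whence the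
factor 5; the constants in the later run lemmas arise in the same way. Both end states have default
registers, so runs can be chained without tracking register contents. -/
theorem run_move (a b : Stk) (hab : a ≠ b) (f : Flags) (S : Stk → List Sym) :
    Run (move a b) (.ofFlags f, S)
      (.ofFlags f, Function.update (Function.update S a []) b ((S a).reverse ++ S b))
      (5 * (S a).length + 1) := by
  generalize hl : S a = l
  induction l generalizing S with
  | nil =>
    refine Run.congr (.loop_false (s := (.ofFlags f, S)) (by simp [hl]) le_rfl) rfl ?_ (by simp)
    rw [← hl, Function.update_eq_self]
    simp [hl]
  | cons x l ih =>
    have h := ih (Function.update (Function.update S a l) b (x :: S b)) (by simp [hab])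
    unfold move at h
    refine .loop_true (by simp [hl]) (.block rfl le_rfl) (s₂ := _)
      (t₂ := 5 * l.length + 1) ?_ (by simp; omega)
    simp only [effs, eff_popD, eff_pushD, eff_resetRegs, Vars.ofFlags, hl] at h ⊢
    convert h using 2
    all_goals
      funext k
      by_cases hb : k = b
      · subst hb; simp [hab.symm]
      · by_cases ha : k = a
        · subst ha; simp [hb]
        · simp [ha, hb]

theorem run_readInput (u : List (Option Bool)) (rest : List Bool) (f : Flags)
    (mat ref ref' cnt c1 c2 c2' acc acc' : List Sym) :
    Run readInput
      (.ofFlags f, stk (u.map .inl ++ rest.map .inr) mat ref ref' cnt c1 c2 c2' acc acc')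
      (.ofFlags f, stk (rest.map .inr) (u.reverse.map .inl ++ mat)
        (List.replicate (u.count none) (.inr true) ++ ref) ref'
        (List.replicate (u.count none) (.inr true) ++ cnt) c1 c2 c2' acc acc')
      (10 * u.length + 1) := by
  induction u generalizing mat ref cnt with
  | nil =>
    refine .loop_false ?_ (by simp)
    cases rest <;> rfl
  | cons x u ih =>
    cases x with
    | none =>
      refine .loop_true rfl (.seq (.block rfl le_rfl) (.seq (.ite_true ?_ (.block rfl le_rfl) le_rfl)
        (.block rfl le_rfl) le_rfl) le_rfl) (s₂ := _) (t₂ := 10 * u.length + 1) ?_ ?_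
      · simp [effs, eff_pop, popD, stk]
      · have h := ih (.inl none :: mat) (.inr true :: ref) (.inr true :: cnt)
        simp only [effs, eff_push, eff_popD, eff_pushD, eff_resetRegs,
          update_inp, update_mat, update_ref,
          update_cnt]
        simp only [stk, List.map_cons, List.cons_append, List.head?_cons, Option.getD_some,
          List.tail_cons, Vars.ofFlags] at h ⊢
        unfold readInput at h
        simpa [List.replicate_succ'] using h
      · simp; omega
    | some b =>
      refine .loop_true rfl (.seq (.block rfl le_rfl) (.seq (.ite_false ?_ (.block rfl le_rfl) le_rfl)
        (.block rfl le_rfl) le_rfl) le_rfl) (s₂ := _) (t₂ := 10 * u.length + 1) ?_ ?_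
      · simp [effs, eff_pop, popD, stk]
      · have h := ih (.inl (some b) :: mat) ref cnt
        simp only [effs, eff_popD, eff_pushD, eff_resetRegs,
          update_inp, update_mat]
        simp only [stk, List.map_cons, List.cons_append, List.head?_cons, Option.getD_some,
          List.tail_cons, Vars.ofFlags] at h ⊢
        unfold readInput at h
        simpa using h
      · simp; omega

theorem run_readBound (T : List Bool) (rest : List Sym) (hrest : isDigit rest.head? = false)
    (f : Flags) (inp ref ref' cnt c1 c2 c2' acc acc' : List Sym) :
    Run readBound
      (.ofFlags f, stk inp (T.map (fun b => .inl (some b)) ++ rest) ref ref' cnt c1 c2 c2' acc acc')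
      (.ofFlags f, stk inp rest (T.reverse.map (fun b => .inl (some b)) ++ ref) ref' cnt c1 c2 c2'
        acc acc') (5 * T.length + 1) := by
  induction T generalizing ref with
  | nil => exact .loop_false hrest (by simp)
  | cons x T ih =>
    refine .loop_true rfl (.block rfl le_rfl) (s₂ := _) (t₂ := 5 * T.length + 1) ?_ ?_
    · have h := ih (.inl (some x) :: ref)
      simp only [effs, eff_popD, eff_pushD, eff_resetRegs,
          update_ref, update_mat]
      simp only [stk, List.map_cons, List.cons_append, List.head?_cons, Option.getD_some,
          List.tail_cons, Vars.ofFlags] at h ⊢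
      unfold readBound at h
      simpa using h
    · simp; omega

/-- The symbols pushed on reading a record from the string `y`. -/
def recordOf : List Sym → List Bool → List Sym
  | [], _ => []
  | r :: N, y => retag r (y.headD false) :: recordOf N y.tail

/-- The flags after reading a record from the string `y`. -/
def Flags.checkRecord : List Sym → List Bool → Flags → Flags
  | [], _, f => f
  | r :: N, y, f => Flags.checkRecord N y.tail (f.check r (y.head?.map .inr))

theorem run_readRecord (N : List Sym) (y : List Bool) (f : Flags)
    (mat ref' cnt c1 c2 c2' acc acc' : List Sym) :
    Run readRecord
      (.ofFlags f, stk (y.map .inr) mat N ref' cnt c1 c2 c2' acc acc')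
      (.ofFlags (f.checkRecord N y), stk ((y.drop N.length).map .inr) mat [] (N.reverse ++ ref') cnt
        ((recordOf N y).reverse ++ c1) ((recordOf N y).reverse ++ c2) c2' acc acc')
      (8 * N.length + 1) := by
  induction N generalizing y f ref' c1 c2 with
  | nil => exact .loop_false rfl (by simp)
  | cons r N ih =>
    refine .loop_true rfl (.block rfl le_rfl) (s₂ := _) (t₂ := 8 * N.length + 1) ?_ ?_
    · have h := ih y.tail (f.check r (y.head?.map .inr)) (r :: ref')
        (retag r (y.headD false) :: c1) (retag r (y.headD false) :: c2)
      simp only [effs, eff_pop, eff_popR, eff_pushR, eff_pushD, eff_resetRegs,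
          update_ref, update_ref',
        update_inp, update_c1, update_c2]
      simp only [stk, List.head?_cons, Option.getD_some, List.tail_cons, Vars.ofFlags] at h ⊢
      unfold readRecord at h
      cases y with
      | nil => simpa [recordOf, Flags.checkRecord] using h
      | cons b y => simpa [recordOf, Flags.checkRecord] using h
    · simp; omega

/-- The records read from the string `y`. -/
def recordsOf (N : List Sym) : ℕ → List Bool → List (List Sym)
  | 0, _ => []
  | k + 1, y => recordOf N y :: recordsOf N k (y.drop N.length)

/-- The flags after reading records from the string `y`. -/
def Flags.checkRecords (N : List Sym) : ℕ → List Bool → Flags → Flags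
  | 0, _, f => f
  | k + 1, y, f => Flags.checkRecords N k (y.drop N.length) (f.checkRecord N y).endRecord

theorem length_recordOf (N : List Sym) (y : List Bool) : (recordOf N y).length = N.length := by
  induction N generalizing y with
  | nil => rfl
  | cons r N ih => simp [recordOf, ih]

theorem length_recordsOf (N : List Sym) (k : ℕ) (y : List Bool) :
    (recordsOf N k y).length = k := by
  induction k generalizing y with
  | zero => rfl
  | succ k ih => simp [recordsOf, ih]

theorem length_of_mem_recordsOf (N : List Sym) (k : ℕ) (y : List Bool) :
    ∀ w ∈ recordsOf N k y, w.length = N.length := by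
  induction k generalizing y with
  | zero => simp [recordsOf]
  | succ k ih => simpa [recordsOf, length_recordOf] using ih _

/-- The reference record acts as a template for the length of each record, and `cnt` supplies the
number of records. Since symbols are pushed as they are read, `c1` and `c2` end up with the last
record on top and each record reversed, which matches the reversed matrix on `mat`. -/
theorem run_readRecords (N : List Sym) (k : ℕ) (y : List Bool) (f : Flags)
    (mat c1 c2 c2' acc acc' : List Sym) :
    Run (.loop .cnt Option.isSome <| .seq (.block [popD .cnt, resetRegs]) <| .seq readRecord <|
      .seq (.block [.load fun v => { v with f := v.f.endRecord }]) (move .ref' .ref))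
      (.ofFlags f, stk (y.map .inr) mat N [] (List.replicate k (.inr true)) c1 c2 c2' acc acc')
      (.ofFlags (f.checkRecords N k y), stk ((y.drop (k * N.length)).map .inr) mat N []
        [] ((recordsOf N k y).flatten.reverse ++ c1) ((recordsOf N k y).flatten.reverse ++ c2)
        c2' acc acc')
      (k * (13 * N.length + 8) + 1) := by
  induction k generalizing y f c1 c2 with
  | zero =>
    exact Run.congr (.loop_false (by rfl) le_rfl) rfl (by simp [recordsOf, Flags.checkRecords])
      (by simp)
  | succ k ih =>
    have h₁ := run_readRecord N y f mat [] (List.replicate k (.inr true)) c1 c2 c2' acc acc'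
    have h₂ := run_move .ref' .ref (by decide) (f.checkRecord N y).endRecord
      (stk ((y.drop N.length).map .inr) mat [] (N.reverse ++ []) (List.replicate k (.inr true))
        ((recordOf N y).reverse ++ c1) ((recordOf N y).reverse ++ c2) c2' acc acc')
    refine .loop_true rfl (.seq (.block ?_ le_rfl) (.seq h₁ (.seq (.block rfl le_rfl) h₂ le_rfl)
      le_rfl) le_rfl) (s₂ := _) (t₂ := k * (13 * N.length + 8) + 1) ?_ ?_
    · simp only [effs, eff_popD, eff_resetRegs,
          update_cnt]
      simp [stk, Vars.ofFlags, List.replicate_succ]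
    · have h := ih (y.drop N.length) (f.checkRecord N y).endRecord ((recordOf N y).reverse ++ c1)
        ((recordOf N y).reverse ++ c2)
      simp only [update_ref, update_ref']
      simp only [stk, List.append_nil, List.reverse_reverse]
      simp only [List.drop_drop] at h
      simpa [recordsOf, Flags.checkRecords, Nat.succ_mul, Nat.add_comm] using h
    · simp [stk]; nlinarith

/-- The final check of the certificate. -/
def Flags.endInput (f : Flags) (y : List Bool) : Flags :=
  { f with bad := f.bad || !y.isEmpty }

theorem run_readCertificate (N : List Sym) (k : ℕ) (y : List Bool) (f : Flags)
    (mat c1 c2 c2' acc acc' : List Sym) :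
    Run readCertificate
      (.ofFlags f, stk (y.map .inr) mat N [] (List.replicate k (.inr true)) c1 c2 c2' acc acc')
      (.ofFlags ((f.checkRecords N k y).endInput (y.drop (k * N.length))),
        stk ((y.drop (k * N.length)).map .inr).tail mat N []
        [] ((recordsOf N k y).flatten.reverse ++ c1) ((recordsOf N k y).flatten.reverse ++ c2)
        c2' acc acc')
      (k * (13 * N.length + 8) + 3) := by
  refine .seq (run_readRecords N k y f mat c1 c2 c2' acc acc') (.block ?_ le_rfl) (by simp)
  simp only [effs, eff_pop, update_inp]
  simp only [stk, Vars.ofFlags, Flags.endInput]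
  cases y.drop (k * N.length) <;> simp

/-- Records carry no end marker, so `ref` is used to measure the length. The detour through `acc'`
reverses the record twice and keeps its orientation. -/
theorem run_loadRecord (w N c1 : List Sym) (hw : w.length = N.length) (f : Flags)
    (inp mat cnt c2 c2' : List Sym) :
    Run loadRecord (.ofFlags f, stk inp mat N [] cnt (w ++ c1) c2 c2' [] [])
      (.ofFlags f, stk inp mat N [] cnt c1 c2 c2' w [])
      (17 * N.length + 3) := by
  have h : ∀ (w N ref' acc' : List Sym), w.length = N.length →
      Run (.loop .ref Option.isSome
        (.block [popR .ref, pushR .ref', popD .c1, pushD .acc', resetRegs]))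
      (.ofFlags f, stk inp mat N ref' cnt (w ++ c1) c2 c2' [] acc')
      (.ofFlags f, stk inp mat [] (N.reverse ++ ref') cnt c1 c2 c2' [] (w.reverse ++ acc'))
      (7 * N.length + 1) := by
    intro w N
    induction N generalizing w with
    | nil =>
      intro ref' acc' hw
      rw [List.length_nil, List.length_eq_zero_iff] at hw
      subst hw
      exact .loop_false rfl (by simp)
    | cons r N ih =>
      intro ref' acc' hw
      obtain ⟨x, w, rfl⟩ := List.exists_cons_of_length_eq_add_one hw
      refine .loop_true rfl (.block rfl le_rfl) (s₂ := _) (t₂ := 7 * N.length + 1) ?_ ?_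
      · have h := ih w (r :: ref') (x :: acc') (by simpa using hw)
        simp only [effs, eff_popR, eff_popD, eff_pushR, eff_pushD, eff_resetRegs,
          update_ref, update_ref',
          update_c1, update_acc']
        simpa [stk, Vars.ofFlags] using h
      · simp; omega
  refine Run.congr (.seq (h w N [] [] hw) (.seq (run_move .acc' .acc (by decide) f _)
    (run_move .ref' .ref (by decide) f _) le_rfl) le_rfl) rfl ?_ ?_
  · simp only [update_acc, update_acc', update_ref, update_ref']
    simp [stk]
  · simp [stk, hw]; omega

/-- The flags after the comparison of two records. -/
def Flags.compareRecords (f : Flags) (a b : List Sym) : Flags :=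
  (a.zip b).foldl (fun f p => f.compare p.1 p.2) f

theorem run_comparePair (e : Bool) (a b : List Sym) (hab : a.length = b.length) (f : Flags)
    (inp mat ref ref' cnt c1 c2 c2' : List Sym) :
    Run comparePair
      (.ofFlags f, stk inp (.inl (some e) :: mat) ref ref' cnt c1 (b ++ c2) c2' a [])
      (.ofFlags ((f.startPair e).compareRecords a b).endPair,
        stk inp mat ref ref' cnt c1 c2 (b.reverse ++ c2') a [])
      (13 * a.length + 6) := by
  have h : ∀ (a b acc' c2' : List Sym) (f : Flags), a.length = b.length →
      Run (.loop .acc Option.isSome (.block [popR .acc, pushR .acc', popD .c2, pushD .c2',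
        .load fun v => { v with f := v.f.compare v.r v.d }, resetRegs]))
      (.ofFlags f, stk inp mat ref ref' cnt c1 (b ++ c2) c2' a acc')
      (.ofFlags (f.compareRecords a b),
        stk inp mat ref ref' cnt c1 c2 (b.reverse ++ c2') [] (a.reverse ++ acc'))
      (8 * a.length + 1) := by
    intro a
    induction a with
    | nil =>
      intro b acc' c2' f hab
      rw [List.length_nil, eq_comm, List.length_eq_zero_iff] at hab
      subst hab
      exact .loop_false rfl (by simp)
    | cons r a ih =>
      intro b acc' c2' f hab
      obtain ⟨x, b, rfl⟩ := List.exists_cons_of_length_eq_add_one hab.symm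
      refine .loop_true rfl (.block rfl le_rfl) (s₂ := _) (t₂ := 8 * a.length + 1) ?_ ?_
      · have h := ih b (r :: acc') (x :: c2') (f.compare r x) (by simpa using hab)
        simp only [effs, eff_load, eff_popR, eff_popD, eff_pushR, eff_pushD, eff_resetRegs,
          update_acc, update_c2,
          update_c2', update_acc']
        simpa [stk, Vars.ofFlags, Flags.compareRecords] using h
      · simp; omega
  refine Run.congr (.seq (.block ?_ le_rfl) (.seq (h a b [] c2' (f.startPair e) hab)
    (.seq (run_move .acc' .acc (by decide) _ _) (.block rfl le_rfl) le_rfl) le_rfl) le_rfl) rfl ?_ ?_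
  · simp only [effs, eff_pop, update_mat]
    simp [stk, Vars.ofFlags]
  · simp only [effs, eff_load, update_acc, update_acc']
    simp [stk, Vars.ofFlags]
  · simp [stk]; omega

/-- The flags after the comparison of a record with a list of records, given the entries of the
matrix. -/
def Flags.compareList (a : List Sym) (f : Flags) (z : List (Bool × List Sym)) : Flags :=
  z.foldl (fun f p => ((f.startPair p.1).compareRecords a p.2).endPair) f

theorem run_comparePairs (a : List Sym) (z : List (Bool × List Sym))
    (hz : ∀ p ∈ z, a.length = p.2.length) (f : Flags) (mat : List Sym)
    (hmat : isDigit mat.head? = false) (inp ref ref' cnt c1 c2 c2' : List Sym) :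
    Run (.loop .mat isDigit comparePair)
      (.ofFlags f, stk inp (z.map (fun p => .inl (some p.1)) ++ mat) ref ref' cnt c1
        ((z.map Prod.snd).flatten ++ c2) c2' a [])
      (.ofFlags (f.compareList a z),
        stk inp mat ref ref' cnt c1 c2 ((z.map Prod.snd).flatten.reverse ++ c2') a [])
      (z.length * (13 * a.length + 7) + 1) := by
  induction z generalizing f c2' with
  | nil => exact .loop_false hmat (by simp)
  | cons p z ih =>
    obtain ⟨e, b⟩ := p
    simp only [List.mem_cons, forall_eq_or_imp] at hz
    have h₁ := run_comparePair e a b hz.1 f inp (z.map (fun p => .inl (some p.1)) ++ mat) ref ref'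
      cnt c1 ((z.map Prod.snd).flatten ++ c2) c2'
    have h₂ := ih hz.2 ((f.startPair e).compareRecords a b).endPair (b.reverse ++ c2')
    refine Run.congr (Run.loop_true rfl h₁ h₂ le_rfl) (by simp) ?_ ?_
    · simp [Flags.compareList]
    · simp only [List.length_cons]; nlinarith

/-- The flags after the comparison of a record with all records. -/
def Flags.compareRow (W : List (List Sym)) (f : Flags) (q : List Bool × List Sym) : Flags :=
  Flags.compareList q.2 { f with seen := false } (q.1.zip W)

/-- A row uses up its own record on `c1`, whereas `c2` is rebuilt from `c2'` at the end, so the next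
row again meets the complete list of records. -/
theorem run_compareRow (W : List (List Sym)) (N : List Sym) (hW : ∀ w ∈ W, w.length = N.length)
    (row : List Bool) (hrow : row.length = W.length) (a : List Sym) (ha : a.length = N.length)
    (f : Flags) (mat : List Sym) (hmat : isDigit mat.head? = false) (inp cnt c1 : List Sym) :
    Run compareRow
      (.ofFlags f, stk inp (.inl none :: row.map (fun b => .inl (some b)) ++ mat) N [] cnt (a ++ c1)
        W.flatten [] [] [])
      (.ofFlags (f.compareRow W (row, a)), stk inp mat N [] cnt c1 W.flatten [] [] [])
      (W.length * (18 * N.length + 7) + 21 * N.length + 9) := by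
  have h₁ := run_loadRecord a N c1 ha { f with seen := false } inp
    (row.map (fun b => .inl (some b)) ++ mat) cnt W.flatten []
  have hz₁ : (row.zip W).map (fun p => (.inl (some p.1) : Sym)) = row.map (fun b => .inl (some b)) := by
    conv_rhs => rw [← List.map_fst_zip hrow.le, List.map_map]
    rfl
  have hz₂ : (row.zip W).map Prod.snd = W := List.map_snd_zip hrow.ge
  have h₂ := run_comparePairs a (row.zip W)
    (fun p hp => by rw [ha, hW p.2 (List.of_mem_zip hp).2]) { f with seen := false } mat hmat inp N
    [] cnt c1 [] []
  rw [hz₁, hz₂] at h₂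
  have h₃ := run_move .c2' .c2 (by decide) (f.compareRow W (row, a))
    (stk inp mat N [] cnt c1 [] W.flatten.reverse a [])
  have h₄ : ∀ l : List Sym, Run (.loop .acc Option.isSome (.block [popD .acc, resetRegs]))
      (.ofFlags (f.compareRow W (row, a)), stk inp mat N [] cnt c1 W.flatten [] l [])
      (.ofFlags (f.compareRow W (row, a)), stk inp mat N [] cnt c1 W.flatten [] [] [])
      (4 * l.length + 1) := by
    intro l
    induction l with
    | nil => exact .loop_false rfl (by simp)
    | cons x l ih =>
      refine .loop_true rfl (.block rfl le_rfl) (t₂ := 4 * l.length + 1) ?_ (by simp; omega)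
      simp only [effs, eff_popD, eff_resetRegs,
          update_acc]
      simpa [stk, Vars.ofFlags] using ih
  have hlen : W.flatten.length = W.length * N.length := by
    rw [List.length_flatten, List.map_congr_left hW]
    simp
  have hzl : (row.zip W).length = W.length := by simp [hrow]
  refine .seq (.block rfl le_rfl) (.seq (s₁ := _) (t₁ := 17 * N.length + 3) ?_
    (.seq h₂ (.seq (s₁ := _) (t₁ := 5 * (W.length * N.length) + 1) ?_ (h₄ a) le_rfl) le_rfl)
    le_rfl) ?_
  · simp only [effs, eff_pop, update_mat]
    simpa [stk, Vars.ofFlags] using h₁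
  · simp only [update_c2, update_c2'] at h₃
    simpa [stk, hlen, Flags.compareRow] using h₃
  · rw [hzl, ha]
    simp only [List.length_cons, List.length_nil]
    nlinarith

theorem run_compareRows (W : List (List Sym)) (N : List Sym) (hW : ∀ w ∈ W, w.length = N.length)
    (p : List (List Bool × List Sym)) (hrow : ∀ q ∈ p, q.1.length = W.length)
    (ha : ∀ q ∈ p, q.2.length = N.length) (f : Flags) (inp cnt : List Sym) :
    Run (.loop .mat Option.isSome compareRow)
      (.ofFlags f, stk inp (p.flatMap fun q => .inl none :: q.1.map (fun b => .inl (some b))) N [] cnt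
        (p.flatMap Prod.snd) W.flatten [] [] [])
      (.ofFlags (p.foldl (Flags.compareRow W) f), stk inp [] N [] cnt [] W.flatten [] [] [])
      (p.length * (W.length * (18 * N.length + 7) + 21 * N.length + 10) + 1) := by
  induction p generalizing f with
  | nil => exact .loop_false rfl (by simp)
  | cons q p ih =>
    obtain ⟨row, a⟩ := q
    simp only [List.mem_cons, forall_eq_or_imp] at hrow ha
    have h₁ := run_compareRow W N hW row hrow.1 a ha.1 f
      (p.flatMap fun q => .inl none :: q.1.map (fun b => .inl (some b)))
      (by cases p <;> rfl) inp cnt (p.flatMap Prod.snd)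
    refine .loop_true rfl (s₁ := _) ?_ (ih hrow.2 ha.2 (f.compareRow W (row, a))) ?_
      (t₁ := W.length * (18 * N.length + 7) + 21 * N.length + 9)
    · simpa using h₁
    · simp only [List.length_cons]; nlinarith

/-! ### The result of the verifier -/

/-- The rows of the matrix of an input. -/
def Input.row (I : Input) (i : Fin I.n) : List Bool := (List.finRange I.n).map (I.prec i)

/-- The reference record of an input. -/
def Input.ref (I : Input) : List Sym :=
  (Computability.encodeNat I.t).map (fun b => .inl (some b)) ++ List.replicate I.n (.inr true)

/-- The flags after reading the certificate `y`. -/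
def Input.readFlags (I : Input) (y : List Bool) : Flags :=
  (Flags.init.checkRecords I.ref I.n y).endInput (y.drop (I.n * I.ref.length))

/-- The reversed records of the certificate `y`, in reverse order. -/
def Input.revRecords (I : Input) (y : List Bool) : List (List Sym) :=
  ((recordsOf I.ref I.n y).map List.reverse).reverse

/-- The flags at the end of the verification. -/
def Input.finalFlags (I : Input) (y : List Bool) : Flags :=
  (((List.finRange I.n).reverse.map fun i => (I.row i).reverse).zip (I.revRecords y)).foldl
    (Flags.compareRow (I.revRecords y)) (I.readFlags y)

theorem length_encode (I : Input) :
    I.encode.length = I.n * (I.n + 1) + (Computability.encodeNat I.t).length := by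
  simp [Input.encode]

theorem length_ref (I : Input) :
    I.ref.length = (Computability.encodeNat I.t).length + I.n := by
  simp [Input.ref]

theorem flatMap_append_singleton_reverse {α β : Type*} (l : List α) (f : α → List β) (b : β) :
    (l.flatMap fun a => f a ++ [b]).reverse = l.reverse.flatMap fun a => b :: (f a).reverse := by
  induction l with
  | nil => rfl
  | cons a l ih => simp [ih]

theorem count_none_map_some {α : Type*} [DecidableEq α] (l : List α) :
    (l.map some).count none = 0 := by
  simp [List.count_eq_zero]

theorem count_none_encode (I : Input) : I.encode.count none = I.n := by
  have h : ∀ l : List (Fin I.n), (l.flatMap fun i =>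
      (List.finRange I.n).map (fun j => some (I.prec i j)) ++ [none]).count none = l.length := by
    intro l
    induction l with
    | nil => rfl
    | cons a l ih =>
      rw [List.flatMap_cons, List.count_append, ih, List.count_append,
        List.count_eq_zero_of_not_mem]
      · simp [Nat.add_comm]
      · simp
  rw [Input.encode, List.count_append, h, count_none_map_some]
  simp

theorem encode_reverse_map_inl (I : Input) :
    (I.encode.reverse.map .inl : List Sym) =
      (Computability.encodeNat I.t).reverse.map (fun b => .inl (some b)) ++
      ((List.finRange I.n).reverse.map fun i => (I.row i).reverse).flatMap
        (fun q => .inl none :: q.map (fun b => .inl (some b))) := by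
  rw [Input.encode, List.reverse_append, flatMap_append_singleton_reverse]
  rw [List.flatMap_map, List.map_append]
  congr 1
  · simp [Function.comp_def]
  · rw [List.map_flatMap]
    simp [Input.row, Function.comp_def]

theorem run_verifier (I : Input) (y : List Bool) :
    ∃ s, Run verifier (.ofFlags .init,
        Function.update (fun _ => []) .inp (encodePair Input.encode (I, y))) s
      (100 * ((encodePair Input.encode (I, y)).length + 1) ^ 3) ∧
      s.1.f = I.finalFlags y := by
  set T := Computability.encodeNat I.t with hT
  set W := I.revRecords y with hW
  set rows := (List.finRange I.n).reverse.map fun i => (I.row i).reverse with hrows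
  have hWlen : W.length = I.n := by simp [hW, Input.revRecords, length_recordsOf]
  have hrlen : rows.length = I.n := by simp [hrows]
  have hWmem : ∀ w ∈ W, w.length = I.ref.length := by
    intro w hw
    simp only [hW, Input.revRecords, List.mem_reverse, List.mem_map] at hw
    obtain ⟨w, hw, rfl⟩ := hw
    rw [List.length_reverse]
    exact length_of_mem_recordsOf _ _ _ w hw
  have hflat : (recordsOf I.ref I.n y).flatten.reverse = W.flatten := by
    rw [hW, Input.revRecords, List.reverse_flatten]
  have h₀ : Function.update (fun _ => []) Stk.inp (encodePair Input.encode (I, y))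
      = stk (I.encode.map .inl ++ y.map .inr) [] [] [] [] [] [] [] [] [] := by
    funext k
    cases k <;> rfl
  have h₁ := run_readInput I.encode y .init [] [] [] [] [] [] [] [] []
  rw [count_none_encode, encode_reverse_map_inl] at h₁
  simp only [List.append_nil] at h₁
  have h₂ := run_readBound T.reverse (rows.flatMap fun q => .inl none :: q.map fun b => .inl (some b))
    (by cases rows <;> rfl) .init (y.map .inr) (List.replicate I.n (.inr true)) []
    (List.replicate I.n (.inr true)) [] [] [] [] []
  rw [List.reverse_reverse] at h₂
  have h₃ := run_readCertificate I.ref I.n y .init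
    (rows.flatMap fun q => .inl none :: q.map fun b => .inl (some b)) [] [] [] [] []
  have hz₁ : (rows.zip W).map Prod.fst = rows := List.map_fst_zip (by omega)
  have hz₂ : (rows.zip W).map Prod.snd = W := List.map_snd_zip (by omega)
  have h₄ := run_compareRows W I.ref hWmem (rows.zip W)
    (fun q hq => by
      have := (List.of_mem_zip hq).1
      simp only [hrows, List.mem_map] at this
      obtain ⟨i, -, hi⟩ := this
      rw [← hi, hWlen]
      simp [Input.row]) (fun q hq => hWmem _ (List.of_mem_zip hq).2) (I.readFlags y)
    ((y.drop (I.n * I.ref.length)).map .inr).tail []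
  have hm : ((rows.zip W).flatMap fun q => (.inl none :: q.1.map fun b => .inl (some b) : List Sym))
      = rows.flatMap fun q => .inl none :: q.map fun b => .inl (some b) := by
    conv_rhs => rw [← hz₁, List.flatMap_map]
  have hc : (rows.zip W).flatMap Prod.snd = W.flatten := by
    conv_rhs => rw [← hz₂]
    rw [List.flatMap_def]
  rw [hm, hc] at h₄
  rw [List.append_nil, hflat] at h₃
  rw [h₀]
  refine ⟨_, .seq h₁ (.seq h₂ (.seq h₃ h₄ le_rfl) le_rfl) ?_, rfl⟩
  have hlen : (encodePair Input.encode (I, y)).length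
      = I.n * (I.n + 1) + T.length + y.length := by
    simp [encodePair, length_encode, hT]
  rw [hlen, length_encode, length_ref, ← hT, List.length_zip, hrlen, hWlen, Nat.min_self,
    List.length_reverse]
  generalize I.n = n
  generalize T.length = m
  generalize y.length = k
  -- Each length occurring in the cost is at most the total length `L` of the string, so the cost is
  -- bounded by a cubic polynomial in `L`.
  have e₁ : n ≤ n * (n + 1) + m + k := by nlinarith
  have e₂ : m ≤ n * (n + 1) + m + k := by nlinarith
  have e₃ : n * (n + 1) + m ≤ n * (n + 1) + m + k := by omega
  have e₄ : m + n ≤ n * (n + 1) + m + k := by nlinarith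
  generalize n * (n + 1) + m + k = L at *
  calc _ ≤ 10 * L + 1 + (5 * L + 1 + (L * (13 * L + 8) + 3
        + (L * (L * (18 * L + 7) + 21 * L + 10) + 1))) := by gcongr
    _ ≤ _ := by
      ring_nf
      nlinarith [Nat.zero_le L, Nat.zero_le (L^2), Nat.zero_le (L^3)]

/-! ### Binary and unary numbers -/

/-- The value of a list of binary digits, the least significant digit first. -/
def binVal : List Bool → ℕ
  | [] => 0
  | b :: l => b.toNat + 2 * binVal l

/-- The last `m` binary digits of a number, the least significant digit first. -/
def bits : ℕ → ℕ → List Bool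
  | 0, _ => []
  | m + 1, v => decide (v % 2 = 1) :: bits m (v / 2)

/-- The number `k` in unary, padded to length `n`. -/
def unary (n k : ℕ) : List Bool := List.replicate k true ++ List.replicate (n - k) false

@[simp] theorem length_bits (m v : ℕ) : (bits m v).length = m := by
  induction m generalizing v with
  | zero => rfl
  | succ m ih => simp [bits, ih]

theorem length_unary {n k : ℕ} (h : k ≤ n) : (unary n k).length = n := by
  simp [unary, h]

theorem binVal_lt (l : List Bool) : binVal l < 2 ^ l.length := by
  induction l with
  | nil => simp [binVal]
  | cons b l ih => cases b <;> simp [binVal, pow_succ] <;> omega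

theorem bits_binVal (l : List Bool) : bits l.length (binVal l) = l := by
  induction l with
  | nil => rfl
  | cons b l ih =>
    have h₁ : (b.toNat + 2 * binVal l) / 2 = binVal l := by cases b <;> simp; omega
    have h₂ : decide ((b.toNat + 2 * binVal l) % 2 = 1) = b := by cases b <;> simp
    simp only [List.length_cons, bits, binVal, h₁, h₂, ih]

theorem binVal_bits {m v : ℕ} (h : v < 2 ^ m) : binVal (bits m v) = v := by
  induction m generalizing v with
  | zero => simp at h; simp [bits, binVal, h]
  | succ m ih =>
    rw [bits, binVal, ih (by rw [pow_succ] at h; omega)]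
    rcases Nat.mod_two_eq_zero_or_one v with h' | h' <;> simp [h'] <;> omega

theorem binVal_encodePosNum (p : PosNum) : binVal (Computability.encodePosNum p) = p := by
  induction p with
  | one => rfl
  | bit0 p ih => simp [Computability.encodePosNum, binVal, ih, PosNum.cast_bit0]; omega
  | bit1 p ih => simp [Computability.encodePosNum, binVal, ih, PosNum.cast_bit1]; omega

theorem binVal_encodeNat (t : ℕ) : binVal (Computability.encodeNat t) = t := by
  conv_rhs => rw [← Num.to_of_nat t]
  rw [Computability.encodeNat]
  cases (t : Num) with
  | zero => rfl
  | pos p => exact binVal_encodePosNum p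

/-- The more significant part decides, and the last digit only breaks ties. This is the recursion
behind both digitwise comparisons: `then` appends digits when reading downwards and prepends them
when reading upwards. -/
theorem compare_binary (b c : Bool) (v w : ℕ) :
    compare (b.toNat + 2 * v) (c.toNat + 2 * w) = (compare v w).then (compare b c) := by
  rcases lt_trichotomy v w with h | h | h
  · rw [compare_lt_iff_lt.2 h, Ordering.lt_then, compare_lt_iff_lt]
    cases b <;> cases c <;> simp <;> omega
  · subst h
    rw [compare_eq_iff_eq.2 (rfl : v = v), Ordering.eq_then]
    cases b <;> cases c <;> simp
    · exact compare_lt_iff_lt.2 (by omega)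
    · exact compare_gt_iff_gt.2 (by omega)
  · rw [compare_gt_iff_gt.2 h, Ordering.gt_then, compare_gt_iff_gt]
    cases b <;> cases c <;> simp <;> omega

/-- Read as a binary number, the padded unary form of `k` is `2 ^ k - 1`, which is strictly
increasing in `k`. So unary numbers can be compared by the digitwise rule used for binary ones. -/
theorem binVal_unary (n k : ℕ) : binVal (unary n k) + 1 = 2 ^ k := by
  rw [unary]
  generalize n - k = j
  induction k with
  | zero =>
    induction j with
    | zero => rfl
    | succ j ih => simpa [List.replicate_succ, binVal] using ih
  | succ k ih =>
    simp only [List.replicate_succ, List.cons_append, binVal, Bool.toNat_true, pow_succ]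
    omega

theorem compare_binVal_unary (n k l : ℕ) :
    compare (binVal (unary n k)) (binVal (unary n l)) = compare k l := by
  have hk := binVal_unary n k
  have hl := binVal_unary n l
  rcases lt_trichotomy k l with h | h | h
  · have := Nat.pow_lt_pow_right (a := 2) (by omega) h
    rw [compare_lt_iff_lt.2 h, compare_lt_iff_lt]
    omega
  · rw [h]
    simp
  · have := Nat.pow_lt_pow_right (a := 2) (by omega) h
    rw [compare_gt_iff_gt.2 h, compare_gt_iff_gt]
    omega

theorem unary_injective {n k k' : ℕ} (h : unary n k = unary n k') :
    k = k' := by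
  have h' := congrArg (List.count true) h
  simpa [unary, List.count_replicate] using h'

theorem unary_zero (n : ℕ) : unary n 0 = List.replicate n false := by simp [unary]

theorem unary_succ (n k : ℕ) : unary (n + 1) (k + 1) = true :: unary n k := by
  simp [unary, List.replicate_succ]

/-! ### The format of certificates -/

section Format

/-- The flag `bad` is never cleared. Hence acceptance at the end means that every intermediate check
has passed. -/
theorem bad_check (r : Sym) (o : Option Sym) (f : Flags) (h : f.bad = true) :
    (f.check r o).bad = true := by
  cases r <;> simp [Flags.check, h]

theorem bad_checkRecord (N : List Sym) (y : List Bool) (f : Flags) (h : f.bad = true) :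
    (f.checkRecord N y).bad = true := by
  induction N generalizing y f with
  | nil => exact h
  | cons r N ih => exact ih _ _ (bad_check r _ f h)

theorem bad_checkRecords (N : List Sym) (k : ℕ) (y : List Bool) (f : Flags) (h : f.bad = true) :
    (f.checkRecords N k y).bad = true := by
  induction k generalizing y f with
  | zero => exact h
  | succ k ih => exact ih _ _ (by simp [Flags.endRecord, bad_checkRecord N y f h])

theorem bad_checkRecord_of_length_lt (N : List Sym) (y : List Bool) (f : Flags)
    (h : y.length < N.length) : (f.checkRecord N y).bad = true := by
  induction N generalizing y f with
  | nil => simp at h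
  | cons r N ih =>
    cases y with
    | nil =>
      refine bad_checkRecord N _ _ ?_
      cases r <;> simp [Flags.check]
    | cons b y => exact ih _ _ (by simpa using h)

theorem checkRecord_append_right (N : List Sym) (w y : List Bool) (f : Flags)
    (h : w.length = N.length) : f.checkRecord N (w ++ y) = f.checkRecord N w := by
  induction N generalizing w f with
  | nil => rfl
  | cons r N ih =>
    obtain ⟨b, w, rfl⟩ := List.exists_cons_of_length_eq_add_one h
    exact ih w _ (by simpa using h)

theorem recordOf_append_right (N : List Sym) (w y : List Bool)
    (h : w.length = N.length) : recordOf N (w ++ y) = recordOf N w := by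
  induction N generalizing w with
  | nil => rfl
  | cons r N ih =>
    obtain ⟨b, w, rfl⟩ := List.exists_cons_of_length_eq_add_one h
    exact congrArg (retag r b :: ·) (ih w (by simpa using h))

theorem checkRecord_append (N₁ N₂ : List Sym) (w₁ w₂ : List Bool) (f : Flags)
    (h : w₁.length = N₁.length) :
    f.checkRecord (N₁ ++ N₂) (w₁ ++ w₂) = (f.checkRecord N₁ w₁).checkRecord N₂ w₂ := by
  induction N₁ generalizing w₁ f with
  | nil =>
    rw [List.length_nil, List.length_eq_zero_iff] at h
    subst h
    rfl
  | cons r N ih =>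
    obtain ⟨b, w, rfl⟩ := List.exists_cons_of_length_eq_add_one h
    exact ih w _ (by simpa using h)

/-- The least significant digit is read first, so each later digit overrides the result so far;
after the last digit `cg` holds the comparison of the two numbers. -/
theorem checkRecord_digits (T w : List Bool) (h : w.length = T.length) (f : Flags) :
    f.checkRecord (T.map fun b => .inl (some b)) w =
      { f with cg := (compare (binVal w) (binVal T)).then f.cg } := by
  induction T generalizing w f with
  | nil =>
    rw [List.length_nil, List.length_eq_zero_iff] at h
    subst h
    simp [Flags.checkRecord, binVal]
  | cons c T ih =>
    obtain ⟨b, w, rfl⟩ := List.exists_cons_of_length_eq_add_one h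
    rw [List.map_cons, Flags.checkRecord, List.tail_cons, ih w (by simpa using h)]
    simp only [Flags.check, List.head?_cons, Option.map_some, digit_some, Option.isNone_some,
      Bool.or_false, Option.getD_some, binVal, Flags.mk.injEq, and_true]
    rw [← Ordering.then_assoc]
    rw [compare_binary]

theorem checkRecord_shape (N : List Sym) (w : List Bool) (f : Flags) :
    ∃ cg z bad, f.checkRecord N w = { f with cg := cg, z := z, bad := bad } := by
  induction N generalizing w f with
  | nil => exact ⟨_, _, _, rfl⟩
  | cons r N ih =>
    obtain ⟨cg, z, bad, h⟩ := ih w.tail (f.check r (w.head?.map .inr))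
    refine ⟨cg, z, bad, ?_⟩
    rw [Flags.checkRecord, h]
    cases r <;> rfl

theorem checkRecord_ones_cg (n : ℕ) (w : List Bool) (f : Flags) :
    (f.checkRecord (List.replicate n (.inr true)) w).cg = f.cg := by
  induction n generalizing w f with
  | zero => rfl
  | succ n ih => exact ih _ _

/-- Once a zero has been read, only zeros may follow. Requiring `z` at the end forces at least one
zero, which is exactly the bound `k < n`. -/
theorem checkRecord_ones (n : ℕ) (w : List Bool) (h : w.length = n) (f : Flags)
    (hf : f.bad = false) :
    ((f.checkRecord (List.replicate n (.inr true)) w).bad = false ∧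
      (f.checkRecord (List.replicate n (.inr true)) w).z = true) ↔
        if f.z then w = List.replicate n false else ∃ k < n, w = unary n k := by
  induction n generalizing w f with
  | zero =>
    rw [List.length_eq_zero_iff] at h
    subst h
    cases hz : f.z <;> simp [hf, hz, Flags.checkRecord]
  | succ n ih =>
    obtain ⟨b, w, rfl⟩ := List.exists_cons_of_length_eq_add_one h
    rw [List.replicate_succ, Flags.checkRecord, List.tail_cons]
    simp only [Flags.check, List.head?_cons, Option.map_some, digit_some, Option.isNone_some,
      Bool.or_false, hf, Bool.false_or]
    have hw : w.length = n := by simpa using h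
    cases hz : f.z with
    | true =>
      cases b with
      | true =>
        rw [bad_checkRecord (List.replicate n (.inr true)) w _ rfl]
        simp [List.replicate_succ]
      | false =>
        have h₁ := ih w hw { f with bad := false, z := true } rfl
        simpa [List.replicate_succ] using h₁
    | false =>
      cases b with
      | true =>
        have h₁ := ih w hw { f with bad := false, z := false } rfl
        refine h₁.trans ?_
        simp only [Bool.false_eq_true, if_false]
        constructor
        · rintro ⟨k, hk, rfl⟩
          exact ⟨k + 1, by omega, (unary_succ n k).symm⟩
        · rintro ⟨k, hk, hw⟩
          cases k with
          | zero => simp [unary_zero, List.replicate_succ] at hw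
          | succ k =>
            rw [unary_succ] at hw
            exact ⟨k, by omega, (List.cons.inj hw).2⟩
      | false =>
        have h₁ := ih w hw { f with bad := false, z := true } rfl
        refine h₁.trans ?_
        simp only [if_true, Bool.false_eq_true, if_false]
        constructor
        · rintro rfl
          exact ⟨0, by omega, by simp [unary_zero, List.replicate_succ]⟩
        · rintro ⟨k, hk, hw⟩
          cases k with
          | zero => simpa [unary_zero, List.replicate_succ] using hw
          | succ k => simp [unary_succ] at hw

theorem bad_endRecord_eq_false (f : Flags) :
    f.endRecord.bad = false ↔ f.bad = false ∧ f.cg = .lt ∧ f.z = true := by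
  simp [Flags.endRecord, and_assoc]

/-- The encoding of one record. -/
def encodeRecord (m n v k : ℕ) : List Bool := bits m v ++ unary n k

theorem bad_record (I : Input) (w : List Bool) (hw : w.length = I.ref.length) :
    (Flags.init.checkRecord I.ref w).endRecord.bad = false ↔
      ∃ (v : Fin I.t) (k : Fin I.n),
        w = encodeRecord (Computability.encodeNat I.t).length I.n v k := by
  set T := Computability.encodeNat I.t with hT
  have hTv : binVal T = I.t := binVal_encodeNat I.t
  rw [length_ref, ← hT] at hw
  obtain ⟨w₁, w₂, rfl, h₁, h₂⟩ : ∃ w₁ w₂, w = w₁ ++ w₂ ∧ w₁.length = T.length ∧ w₂.length = I.n :=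
    ⟨w.take T.length, w.drop T.length, by simp, by simp [hw], by simp [hw]⟩
  rw [Input.ref, checkRecord_append _ _ _ _ _ (by simpa using h₁), checkRecord_digits _ _ h₁,
    bad_endRecord_eq_false, checkRecord_ones_cg, _root_.and_left_comm,
    checkRecord_ones _ _ h₂ _ (by rfl)]
  simp only [Flags.init, Ordering.then_eq, compare_lt_iff_lt, Bool.false_eq_true, if_false,
    hTv]
  constructor
  · rintro ⟨hv, k, hk, rfl⟩
    refine ⟨⟨_, hv⟩, ⟨k, hk⟩, ?_⟩
    rw [encodeRecord, ← h₁, bits_binVal]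
  · rintro ⟨v, k, h⟩
    obtain ⟨rfl, rfl⟩ := List.append_inj h (by simp [h₁])
    refine ⟨?_, k, k.2, rfl⟩
    rw [binVal_bits]
    · exact v.2
    -- As `v < t < 2 ^ T.length`, the number `v` fits into as many digits as `t` has.
    · have := binVal_lt T
      have := v.2
      omega

/-- Reading a record changes only `cg`, `z` and `bad`, and the end of the record resets the first
two. So a correct record leaves the initial flags, and the records are checked independently of each
other. -/
theorem checkRecord_endRecord_of_bad (N : List Sym) (w : List Bool)
    (h : (Flags.init.checkRecord N w).endRecord.bad = false) :
    (Flags.init.checkRecord N w).endRecord = Flags.init := by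
  obtain ⟨cg, z, bad, h'⟩ := checkRecord_shape N w .init
  rw [h'] at h ⊢
  simp only [Flags.endRecord, Flags.init] at h ⊢
  rw [h]

theorem checkRecords_good (N : List Sym) (ws : List (List Bool)) (hw : ∀ w ∈ ws, w.length = N.length)
    (h : ∀ w ∈ ws, (Flags.init.checkRecord N w).endRecord.bad = false) :
    Flags.init.checkRecords N ws.length ws.flatten = .init := by
  induction ws with
  | nil => rfl
  | cons w ws ih =>
    simp only [List.mem_cons, forall_eq_or_imp] at hw h
    rw [List.length_cons, List.flatten_cons, Flags.checkRecords, checkRecord_append_right _ _ _ _ hw.1,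
      checkRecord_endRecord_of_bad _ _ h.1, ← hw.1, List.drop_left]
    exact ih hw.2 h.2

theorem recordsOf_flatten (N : List Sym) (ws : List (List Bool))
    (hw : ∀ w ∈ ws, w.length = N.length) :
    recordsOf N ws.length ws.flatten = ws.map (recordOf N) := by
  induction ws with
  | nil => rfl
  | cons w ws ih =>
    simp only [List.mem_cons, forall_eq_or_imp] at hw
    rw [List.length_cons, List.flatten_cons, recordsOf, recordOf_append_right _ _ _ hw.1, ← hw.1,
      List.drop_left, List.map_cons, ih hw.2]

/-- A missing symbol sets `bad`, so a string that passes is long enough for each record to be cut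
off in full; `hy` excludes leftover symbols. -/
theorem exists_records_of_bad (N : List Sym) (k : ℕ) (y : List Bool)
    (h : (Flags.init.checkRecords N k y).bad = false) (hy : y.drop (k * N.length) = []) :
    ∃ ws : List (List Bool), ws.length = k ∧ y = ws.flatten ∧ ∀ w ∈ ws, w.length = N.length ∧
      (Flags.init.checkRecord N w).endRecord.bad = false := by
  induction k generalizing y with
  | zero => exact ⟨[], rfl, by simpa using hy, by simp⟩
  | succ k ih =>
    rw [Flags.checkRecords] at h
    have h₁ : (Flags.init.checkRecord N y).endRecord.bad = false := by
      by_contra h'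
      rw [Bool.not_eq_false] at h'
      simp [bad_checkRecords _ _ _ _ h'] at h
    have h₂ : N.length ≤ y.length := by
      by_contra h'
      rw [bad_endRecord_eq_false, bad_checkRecord_of_length_lt _ _ _ (not_le.1 h')] at h₁
      simp at h₁
    rw [checkRecord_endRecord_of_bad _ _ h₁] at h
    obtain ⟨ws, h₃, h₄, h₅⟩ := ih (y.drop N.length) h (by
      rw [List.drop_drop, ← hy, Nat.succ_mul, Nat.add_comm])
    have h₆ : (y.take N.length).length = N.length := by simpa using h₂
    refine ⟨y.take N.length :: ws, by simp [h₃], by simp [← h₄], ?_⟩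
    simp only [List.mem_cons, forall_eq_or_imp]
    refine ⟨⟨h₆, ?_⟩, h₅⟩
    rw [← checkRecord_append_right _ _ (y.drop N.length) _ h₆, List.take_append_drop]
    exact h₁

end Format

/-! ### The comparison of records -/

theorem compareRecords_append (a b a' b' : List Sym) (h : a.length = b.length) (f : Flags) :
    f.compareRecords (a ++ a') (b ++ b') = (f.compareRecords a b).compareRecords a' b' := by
  simp [Flags.compareRecords, List.zip_append h]

/-- Reversal puts the most significant digit first, so the first difference decides. The induction
removes the least significant digit, which is compared last. -/
theorem compareRecords_ones (a b : List Bool) (h : a.length = b.length) (f : Flags) :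
    f.compareRecords (a.map .inr).reverse (b.map .inr).reverse =
      { f with cs := f.cs.then (compare (binVal a) (binVal b)) } := by
  induction a generalizing b f with
  | nil =>
    rw [List.length_nil, eq_comm, List.length_eq_zero_iff] at h
    subst h
    simp [Flags.compareRecords, binVal]
  | cons x a ih =>
    obtain ⟨z, b, rfl⟩ := List.exists_cons_of_length_eq_add_one h.symm
    rw [List.map_cons, List.map_cons, List.reverse_cons, List.reverse_cons,
      compareRecords_append _ _ _ _ (by simpa using h), ih b (by simpa using h), binVal, binVal,
      compare_binary, ← Ordering.then_assoc]
    rfl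

theorem compareRecords_digits (a b : List Bool) (h : a.length = b.length) (f : Flags) :
    f.compareRecords (a.map fun b => .inl (some b)).reverse (b.map fun b => .inl (some b)).reverse =
      { f with cg := f.cg.then (compare (binVal a) (binVal b)) } := by
  induction a generalizing b f with
  | nil =>
    rw [List.length_nil, eq_comm, List.length_eq_zero_iff] at h
    subst h
    simp [Flags.compareRecords, binVal]
  | cons x a ih =>
    obtain ⟨z, b, rfl⟩ := List.exists_cons_of_length_eq_add_one h.symm
    rw [List.map_cons, List.map_cons, List.reverse_cons, List.reverse_cons,
      compareRecords_append _ _ _ _ (by simpa using h), ih b (by simpa using h), binVal, binVal,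
      compare_binary, ← Ordering.then_assoc]
    rfl

theorem recordOf_append (N₁ N₂ : List Sym) (w₁ w₂ : List Bool) (h : w₁.length = N₁.length) :
    recordOf (N₁ ++ N₂) (w₁ ++ w₂) = recordOf N₁ w₁ ++ recordOf N₂ w₂ := by
  induction N₁ generalizing w₁ with
  | nil =>
    rw [List.length_nil, List.length_eq_zero_iff] at h
    subst h
    rfl
  | cons r N ih =>
    obtain ⟨b, w, rfl⟩ := List.exists_cons_of_length_eq_add_one h
    exact congrArg (retag r b :: ·) (ih w (by simpa using h))

theorem recordOf_digits (T w : List Bool) (h : w.length = T.length) :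
    recordOf (T.map fun b => .inl (some b)) w = w.map fun b => .inl (some b) := by
  induction T generalizing w with
  | nil =>
    rw [List.length_nil, List.length_eq_zero_iff] at h
    subst h
    rfl
  | cons r N ih =>
    obtain ⟨b, w, rfl⟩ := List.exists_cons_of_length_eq_add_one h
    exact congrArg (Sum.inl (some b) :: ·) (ih w (by simpa using h))

theorem recordOf_ones (n : ℕ) (w : List Bool) (h : w.length = n) :
    recordOf (List.replicate n (.inr true)) w = w.map .inr := by
  induction n generalizing w with
  | zero =>
    rw [List.length_eq_zero_iff] at h
    subst h
    rfl
  | succ n ih =>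
    obtain ⟨b, w, rfl⟩ := List.exists_cons_of_length_eq_add_one h
    exact congrArg (Sum.inr b :: ·) (ih w (by simpa using h))

theorem recordOf_encodeRecord (I : Input) (v k : ℕ) (hk : k ≤ I.n) :
    recordOf I.ref (encodeRecord (Computability.encodeNat I.t).length I.n v k) =
      (bits (Computability.encodeNat I.t).length v).map (fun b => .inl (some b)) ++
        (unary I.n k).map .inr := by
  rw [Input.ref, encodeRecord, recordOf_append _ _ _ _ (by simp), recordOf_digits _ _ (by simp),
    recordOf_ones _ _ (length_unary hk)]

theorem compareRecords_encodeRecord (I : Input) (v v' : Fin I.t) (k k' : Fin I.n) (f : Flags) :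
    f.compareRecords
      (recordOf I.ref (encodeRecord (Computability.encodeNat I.t).length I.n v k)).reverse
      (recordOf I.ref (encodeRecord (Computability.encodeNat I.t).length I.n v' k')).reverse =
      { f with
        cg := f.cg.then (compare v v')
        cs := f.cs.then (compare k k') } := by
  have ht := binVal_lt (Computability.encodeNat I.t)
  rw [binVal_encodeNat] at ht
  rw [recordOf_encodeRecord _ _ _ k.2.le, recordOf_encodeRecord _ _ _ k'.2.le, List.reverse_append,
    List.reverse_append, compareRecords_append _ _ _ _
      (by simp [length_unary k.2.le, length_unary k'.2.le]),
    compareRecords_ones _ _ (by simp [length_unary k.2.le, length_unary k'.2.le]),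
    compareRecords_digits _ _ (by simp), compare_binVal_unary,
    binVal_bits (v.2.trans ht), binVal_bits (v'.2.trans ht)]
  rfl

theorem bad_compare (f : Flags) (r d : Sym) : (f.compare r d).bad = f.bad := by
  unfold Flags.compare
  split <;> rfl

theorem bad_compareRecords (f : Flags) (a b : List Sym) : (f.compareRecords a b).bad = f.bad := by
  rw [Flags.compareRecords]
  generalize a.zip b = l
  induction l generalizing f with
  | nil => rfl
  | cons p l ih => rw [List.foldl_cons, ih, bad_compare]

theorem bad_compareList (a : List Sym) (f : Flags) (z : List (Bool × List Sym))
    (h : f.bad = true) : (f.compareList a z).bad = true := by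
  induction z generalizing f with
  | nil => exact h
  | cons p z ih =>
    refine ih _ ?_
    simp [Flags.endPair, bad_compareRecords, Flags.startPair, h]

theorem bad_foldl_compareRow (W : List (List Sym)) (p : List (List Bool × List Sym)) (f : Flags)
    (h : f.bad = true) : (p.foldl (Flags.compareRow W) f).bad = true := by
  induction p generalizing f with
  | nil => exact h
  | cons q p ih => exact ih _ (bad_compareList _ _ _ h)

/-- The encodings `r i` of the pairs `(v i, s i)` are compared correctly. -/
def CompareSpec {n t : ℕ} (r : Fin n → List Sym) (v : Fin n → Fin t) (s : Fin n → Fin n) : Prop :=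
  ∀ i j (f : Flags), f.compareRecords (r i) (r j) =
    { f with
      cg := f.cg.then (compare (v i) (v j))
      cs := f.cs.then (compare (s i) (s j)) }

/-! ### Comparison of all pairs of records -/

section Fold

variable {n t : ℕ} {r : Fin n → List Sym} {v : Fin n → Fin t} {s : Fin n → Fin n}

/-- The starting flags are arbitrary so that the induction can pass through them. The clause on
`seen` and the pairwise clause together say that `s i` is met at most once, counting an earlier
occurrence recorded in `seen`. -/
theorem compareList_iff (hr : CompareSpec r v s) (P : Fin n → Fin n → Bool) (i : Fin n)
    (L : List (Fin n)) (f : Flags) :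
    ((f.compareList (r i) (L.map fun j => (P i j, r j))).bad = false ↔
      f.bad = false ∧ (∀ j ∈ L, P i j = true → v i ≤ v j) ∧
      (f.seen = true → ∀ j ∈ L, s i ≠ s j) ∧ L.Pairwise fun a b => s i = s a → s i ≠ s b) ∧
    ((f.compareList (r i) (L.map fun j => (P i j, r j))).found = true ↔
      f.found = true ∨ ∃ j ∈ L, P i j = true ∧ v i = v j ∧ s j < s i) := by
  induction L generalizing f with
  | nil => simp [Flags.compareList]
  | cons j L ih =>
    have h := ih ((f.startPair (P i j)).compareRecords (r i) (r j)).endPair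
    rw [List.map_cons]
    simp only [Flags.compareList, List.foldl_cons] at h ⊢
    rw [h.1, h.2, hr]
    simp only [Flags.endPair, Flags.startPair, Ordering.eq_then, List.mem_cons, forall_eq_or_imp,
      List.pairwise_cons, Bool.or_eq_false_iff, Bool.and_eq_false_iff, decide_eq_false_iff_not,
      compare_gt_iff_gt, compare_eq_iff_eq, Bool.or_eq_true, Bool.and_eq_true, decide_eq_true_eq,
      exists_eq_or_imp, not_lt]
    constructor
    · cases P i j <;> cases f.seen <;> simp <;> grind
    · grind

theorem compareRow_iff (hr : CompareSpec r v s) (P : Fin n → Fin n → Bool) (i : Fin n)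
    (L : List (Fin n)) (f : Flags) :
    ((Flags.compareRow (L.map r) f (L.map (P i), r i)).bad = false ↔
      f.bad = false ∧ (∀ j ∈ L, P i j = true → v i ≤ v j) ∧
      L.Pairwise fun a b => s i = s a → s i ≠ s b) ∧
    ((Flags.compareRow (L.map r) f (L.map (P i), r i)).found = true ↔
      f.found = true ∨ ∃ j ∈ L, P i j = true ∧ v i = v j ∧ s j < s i) := by
  have h := compareList_iff hr P i L { f with seen := false }
  rw [Flags.compareRow, List.zip_map']
  simpa using h

theorem compareRows_iff (hr : CompareSpec r v s) (P : Fin n → Fin n → Bool)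
    (L L' : List (Fin n)) (f : Flags) :
    (((L'.map fun i => (L.map (P i), r i)).foldl (Flags.compareRow (L.map r)) f).bad = false ↔
      f.bad = false ∧ ∀ i ∈ L', (∀ j ∈ L, P i j = true → v i ≤ v j) ∧
        L.Pairwise fun a b => s i = s a → s i ≠ s b) ∧
    (((L'.map fun i => (L.map (P i), r i)).foldl (Flags.compareRow (L.map r)) f).found = true ↔
      f.found = true ∨ ∃ i ∈ L', ∃ j ∈ L, P i j = true ∧ v i = v j ∧ s j < s i) := by
  induction L' generalizing f with
  | nil => simp
  | cons i L' ih =>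
    have h := ih (Flags.compareRow (L.map r) f (L.map (P i), r i))
    have h' := compareRow_iff hr P i L f
    rw [List.map_cons, List.foldl_cons, h.1, h.2, h'.1, h'.2]
    simp only [List.mem_cons, forall_eq_or_imp, exists_eq_or_imp, and_assoc, or_assoc, and_self]

/-- Row `i` also compares record `i` with itself, so one match is always present. Forbidding a
second match in each row is therefore the same as injectivity. -/
theorem pairwise_ne_iff_injective {L : List (Fin n)} (hL : L.Nodup) (hmem : ∀ i, i ∈ L) :
    (∀ i ∈ L, L.Pairwise fun a b => s i = s a → s i ≠ s b) ↔ Function.Injective s := by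
  constructor
  · intro h i j hij
    by_contra hne
    have hsymm : Std.Symm fun a b => s i = s a → s i ≠ s b :=
      ⟨fun a b hab hb ha => hab ha hb⟩
    exact (h i (hmem i)).forall (hmem i) (hmem j) hne rfl hij
  · intro h i _
    refine hL.imp fun {a b} hab ha hb => hab (h (ha.symm.trans hb))

end Fold

/-- The certificate for a pair of maps. -/
def encodeCert (I : Input) (v : Fin I.n → Fin I.t) (s : Fin I.n → Fin I.n) : List Bool :=
  (List.finRange I.n).flatMap fun i =>
    encodeRecord (Computability.encodeNat I.t).length I.n (v i) (s i)

/-- The condition on a pair of maps which is verified. -/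
def Input.Good (I : Input) (v : Fin I.n → Fin I.t) (s : Fin I.n → Fin I.n) : Prop :=
  (∀ i j, I.prec i j = true → v i ≤ v j) ∧ Function.Injective s ∧
    ∃ i j, I.prec i j = true ∧ v i = v j ∧ s j < s i

/-! ### Accepted strings are the encodings of good pairs -/

theorem length_encodeRecord (I : Input) (v : ℕ) (k : Fin I.n) :
    (encodeRecord (Computability.encodeNat I.t).length I.n v k).length = I.ref.length := by
  simp [encodeRecord, length_unary k.2.le, length_ref]

theorem length_encodeCert (I : Input) (v : Fin I.n → Fin I.t) (s : Fin I.n → Fin I.n) :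
    (encodeCert I v s).length = I.n * I.ref.length := by
  simp [encodeCert, List.length_flatMap, length_encodeRecord]

theorem readFlags_encodeCert (I : Input) (v : Fin I.n → Fin I.t) (s : Fin I.n → Fin I.n) :
    I.readFlags (encodeCert I v s) = .init := by
  have hlen := length_encodeCert I v s
  have h := checkRecords_good I.ref ((List.finRange I.n).map fun i =>
    encodeRecord (Computability.encodeNat I.t).length I.n (v i) (s i))
    (by simp [length_encodeRecord])
    (by
      simp only [List.mem_map, forall_exists_index, and_imp]
      rintro w i - rfl
      exact (bad_record I _ (length_encodeRecord _ _ _)).2 ⟨_, _, rfl⟩)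
  rw [List.length_map, List.length_finRange, ← List.flatMap_def] at h
  rw [Input.readFlags, ← hlen, List.drop_length, encodeCert, h]
  rfl

theorem bad_readFlags (I : Input) (y : List Bool) :
    (I.readFlags y).bad = false ↔ ∃ v s, y = encodeCert I v s := by
  constructor
  · intro h
    simp only [Input.readFlags, Flags.endInput, Bool.or_eq_false_iff, Bool.not_eq_false',
      List.isEmpty_iff] at h
    obtain ⟨ws, hlen, rfl, hws⟩ := exists_records_of_bad _ _ _ h.1 h.2
    have h' : ∀ i : Fin I.n, ∃ (v : Fin I.t) (k : Fin I.n), ws[i] =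
        encodeRecord (Computability.encodeNat I.t).length I.n v k := fun i =>
      (bad_record I _ (hws _ (List.getElem_mem _)).1).1 (hws _ (List.getElem_mem _)).2
    choose v s hvs using h'
    refine ⟨v, s, ?_⟩
    rw [encodeCert, List.flatMap_def]
    congr 1
    refine List.ext_getElem (by simp [hlen]) fun i h₁ h₂ => ?_
    simpa using hvs ⟨i, hlen ▸ h₁⟩
  · rintro ⟨v, s, rfl⟩
    rw [readFlags_encodeCert]
    rfl

/-- A wrong format sets `bad`, which survives all comparisons. Otherwise the string is the encoding
of some pair, the flags after reading are the initial ones, and `compareRows_iff` evaluates the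
comparisons. -/
theorem finalFlags_iff (I : Input) (y : List Bool) :
    ((I.finalFlags y).bad = false ∧ (I.finalFlags y).found = true) ↔
      ∃ v s, y = encodeCert I v s ∧ I.Good v s := by
  have key : ∀ v s, ((I.finalFlags (encodeCert I v s)).bad = false ∧
      (I.finalFlags (encodeCert I v s)).found = true) ↔ I.Good v s := by
    intro v s
    set r : Fin I.n → List Sym := fun i => (recordOf I.ref
      (encodeRecord (Computability.encodeNat I.t).length I.n (v i) (s i))).reverse
    have hr : CompareSpec r v s := fun i j f => compareRecords_encodeRecord I _ _ _ _ f
    set L := (List.finRange I.n).reverse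
    have hL : L.Nodup := List.nodup_reverse.2 (List.nodup_finRange _)
    have hmem : ∀ i, i ∈ L := by simp [L]
    have hrec := recordsOf_flatten I.ref ((List.finRange I.n).map fun i =>
      encodeRecord (Computability.encodeNat I.t).length I.n (v i) (s i))
      (by simp [length_encodeRecord])
    rw [List.length_map, List.length_finRange, ← List.flatMap_def] at hrec
    have hW : I.revRecords (encodeCert I v s) = L.map r := by
      rw [Input.revRecords, encodeCert, hrec]
      simp [L, r, Function.comp_def]
    have hrow : (L.map fun i => (I.row i).reverse).zip (L.map r)
        = L.map fun i => (L.map (I.prec i), r i) := by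
      rw [List.zip_map']
      simp [Input.row, L]
    have h := compareRows_iff hr I.prec L L .init
    rw [Input.finalFlags, hW, hrow, readFlags_encodeCert, h.1, h.2]
    simp only [forall_and, pairwise_ne_iff_injective hL hmem]
    simp [hmem, Input.Good, Flags.init, and_assoc]
  constructor
  · intro h
    obtain ⟨v, s, rfl⟩ : ∃ v s, y = encodeCert I v s := by
      rw [← bad_readFlags]
      by_contra h'
      rw [Bool.not_eq_false] at h'
      rw [Input.finalFlags, bad_foldl_compareRow _ _ _ h'] at h
      simp at h
    exact ⟨v, s, rfl, (key v s).1 h⟩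
  · rintro ⟨v, s, rfl, h⟩
    exact (key v s).2 h

theorem encodeCert_injective (I : Input) {v v' : Fin I.n → Fin I.t} {s s' : Fin I.n → Fin I.n}
    (h : encodeCert I v s = encodeCert I v' s') : v = v' ∧ s = s' := by
  have ht := binVal_lt (Computability.encodeNat I.t)
  rw [binVal_encodeNat] at ht
  have h₁ : ∀ l : List (Fin I.n), (l.flatMap fun i =>
        encodeRecord (Computability.encodeNat I.t).length I.n (v i) (s i)) =
      (l.flatMap fun i => encodeRecord (Computability.encodeNat I.t).length I.n (v' i) (s' i)) →
      ∀ i ∈ l, v i = v' i ∧ s i = s' i := by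
    intro l
    induction l with
    | nil => simp
    | cons a l ih =>
      intro h
      rw [List.flatMap_cons, List.flatMap_cons] at h
      obtain ⟨h₁, h₂⟩ := List.append_inj h (by simp [length_encodeRecord])
      obtain ⟨h₃, h₄⟩ := List.append_inj h₁ (by simp)
      simp only [List.mem_cons, forall_eq_or_imp]
      refine ⟨⟨Fin.ext ?_, Fin.ext (unary_injective h₄)⟩, ih h₂⟩
      rw [← binVal_bits ((v a).2.trans ht), h₃, binVal_bits ((v' a).2.trans ht)]
  have h₂ := h₁ _ h
  exact ⟨funext fun i => (h₂ i (List.mem_finRange i)).1,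
    funext fun i => (h₂ i (List.mem_finRange i)).2⟩

/-! ### The map `Ψ` -/

section Psi

variable {X : Type*} [Fintype X] [PartialOrder X] {t : ℕ} (ℓ : X ≃ Fin (Fintype.card X))

/-- With `s = σ ∘ (blockOrder ℓ g)⁻¹ ∘ ℓ`, the left side says `s = sort β ∘ f` and `g = β ∘ s`,
while the right side is the solution `β = g ∘ s⁻¹`, `f = (sort β)⁻¹ ∘ s` of these equations. -/
theorem psi_eq_iff (f : LinExt X) (β : Fin (Fintype.card X) → Fin t) (g : X →o Fin t)
    (σ : Equiv.Perm (Fin (Fintype.card X))) :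
    psi ℓ (f, β) = (g, σ) ↔ psiInvMap ℓ g σ = f.1 ∧ psiInvPart ℓ g σ = β := by
  have hg : psiMap f β = g ↔ ∀ x, β (Tuple.sort β (f.1 x)) = g x := by
    rw [OrderHom.ext_iff, funext_iff]
    rfl
  rw [psi, Prod.mk.injEq]
  constructor
  · rintro ⟨rfl, rfl⟩
    have hpart : psiInvPart ℓ (psiMap f β) (psiPerm ℓ f β) = β := by
      funext k
      have h : ∀ x, psiMap f β x = β (Tuple.sort β (f.1 x)) := fun _ => rfl
      simp [psiInvPart, psiPerm, h]
    refine ⟨?_, hpart⟩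
    rw [psiInvMap, hpart]
    ext x
    simp [psiPerm]
  · rintro ⟨hf, rfl⟩
    have hx : ∀ x, Tuple.sort (psiInvPart ℓ g σ) (f.1 x) = σ ((blockOrder ℓ g).symm (ℓ x)) := by
      intro x
      rw [← hf]
      simp [psiInvMap]
    have hg' : psiMap f (psiInvPart ℓ g σ) = g := by
      rw [hg]
      intro x
      rw [hx]
      simp [psiInvPart]
    refine ⟨hg', ?_⟩
    rw [psiPerm, hg']
    ext k
    simp [hx]

theorem psi_injective : Function.Injective (psi (t := t) ℓ) := by
  rintro ⟨f, β⟩ ⟨f', β'⟩ h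
  have h₁ := (psi_eq_iff ℓ f β _ _).1 (h.trans (Prod.mk.eta).symm)
  have h₂ := (psi_eq_iff ℓ f' β' _ _).1 (Prod.mk.eta).symm
  exact Prod.ext (Subtype.ext (h₁.1.symm.trans h₂.1)) (h₁.2.symm.trans h₂.2)

instance : Finite (X →o Fin t) := DFunLike.finite _

theorem zeta_eq_card :
    zeta X t = (Nat.card {q : (X →o Fin t) × Equiv.Perm (Fin (Fintype.card X)) //
      ¬ StrictMono (psiInvMap ℓ q.1 q.2)} : ℤ) := by
  classical
  have h₁ : Nat.card {q : (X →o Fin t) × Equiv.Perm (Fin (Fintype.card X)) //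
      StrictMono (psiInvMap ℓ q.1 q.2)} = numLinExt X * t ^ Fintype.card X := by
    -- The image of `Ψ` consists of the pairs whose `h` is a linear extension: for such a pair `(h,
    -- π)` is itself an admissible argument of `Ψ`.
    have e : LinExt X × (Fin (Fintype.card X) → Fin t) ≃
        {q : (X →o Fin t) × Equiv.Perm (Fin (Fintype.card X)) //
          StrictMono (psiInvMap ℓ q.1 q.2)} := by
      refine Equiv.ofBijective (fun q => ⟨psi ℓ q, ?_⟩) ⟨fun q q' h => ?_, ?_⟩
      · rw [((psi_eq_iff ℓ q.1 q.2 (psi ℓ q).1 (psi ℓ q).2).1 rfl).1]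
        exact q.1.2
      · exact psi_injective ℓ (congrArg Subtype.val h)
      · rintro ⟨⟨g, σ⟩, h⟩
        exact ⟨(⟨psiInvMap ℓ g σ, h⟩, psiInvPart ℓ g σ),
          Subtype.ext ((psi_eq_iff ℓ _ _ g σ).2 ⟨rfl, rfl⟩)⟩
    rw [← Nat.card_congr e, Nat.card_prod, numLinExt, Nat.card_fun]
    simp
  have h₂ : Nat.card ((X →o Fin t) × Equiv.Perm (Fin (Fintype.card X)))
      = orderPoly X t * (Fintype.card X)! := by
    rw [Nat.card_prod, orderPoly, Nat.card_perm]
    simp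
  have h₃ := Nat.card_congr (Equiv.sumCompl
    fun q : (X →o Fin t) × Equiv.Perm (Fin (Fintype.card X)) => StrictMono (psiInvMap ℓ q.1 q.2))
  rw [Nat.card_sum, h₁, h₂] at h₃
  rw [zeta]
  have h₄ := congrArg (Nat.cast : ℕ → ℤ) h₃
  push_cast at h₄
  linarith

/-- Stability: along the sorted order the pairs (value, index) increase strictly in the
lexicographic order. -/
theorem sort_symm_lt_iff {n : ℕ} {α : Type*} [LinearOrder α] (β : Fin n → α) (i j : Fin n) :
    (Tuple.sort β).symm i < (Tuple.sort β).symm j ↔ β i < β j ∨ β i = β j ∧ i < j := by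
  have h : StrictMono fun i => toLex (β (Tuple.sort β i), Tuple.sort β i) := by
    intro a b hab
    exact (Tuple.eq_sort_iff'.1 (rfl : Tuple.sort β = Tuple.sort β)) hab
  rw [← h.lt_iff_lt]
  simp [Prod.Lex.toLex_lt_toLex]

/-- The pairs `(g, σ)` correspond to the pairs `(g, s)` where `s x` is the entry of `σ` at the
position of `x`. -/
theorem strictMono_psiInvMap_iff (g : X →o Fin t) (σ : Equiv.Perm (Fin (Fintype.card X))) :
    StrictMono (psiInvMap ℓ g σ) ↔ ∀ x y, x < y → g x = g y →
      (ℓ.trans ((blockOrder ℓ g).symm.trans σ)) x < (ℓ.trans ((blockOrder ℓ g).symm.trans σ)) y := by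
  -- The blocks satisfy `π (s x) = g x`, so sorting `π` ranks the elements by `g x` first and by `s
  -- x` within a block.
  have h : ∀ x y, psiInvMap ℓ g σ x < psiInvMap ℓ g σ y ↔ g x < g y ∨ g x = g y ∧
      σ ((blockOrder ℓ g).symm (ℓ x)) < σ ((blockOrder ℓ g).symm (ℓ y)) := by
    intro x y
    simp only [psiInvMap, Equiv.trans_apply, sort_symm_lt_iff]
    simp [psiInvPart]
  constructor
  · intro hs x y hxy hg
    rcases (h x y).1 (hs hxy) with h' | h'
    · exact absurd hg h'.ne
    · exact h'.2
  · intro hs x y hxy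
    rw [h]
    rcases (g.monotone hxy.le).lt_or_eq with h' | h'
    · exact Or.inl h'
    · exact Or.inr ⟨h', hs x y hxy h'⟩

theorem zeta_eq_card_inversions :
    zeta X t = (Nat.card {q : (X →o Fin t) × (X ≃ Fin (Fintype.card X)) //
      ∃ x y, x < y ∧ q.1 x = q.1 y ∧ q.2 y < q.2 x} : ℤ) := by
  rw [zeta_eq_card (Fintype.equivFin X)]
  set ℓ := Fintype.equivFin X
  congr 1
  refine Nat.card_congr (Equiv.subtypeEquiv
    -- The passage from `σ` to `s` depends on `g`, but is a bijection for each fixed `g`.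
    (Equiv.prodShear (Equiv.refl _) fun g : X →o Fin t =>
      (Equiv.equivCongr (ℓ.trans (blockOrder ℓ g).symm) (Equiv.refl _)).symm) ?_)
  rintro ⟨g, σ⟩
  rw [strictMono_psiInvMap_iff]
  push Not
  refine exists_congr fun x => exists_congr fun y => and_congr_right fun hxy =>
    and_congr_right fun hg => ?_
  have hne : ∀ s : X ≃ Fin (Fintype.card X), s y ≤ s x ↔ s y < s x := fun s =>
    ⟨fun h => lt_of_le_of_ne h fun h' => hxy.ne' (s.injective h'), le_of_lt⟩
  rw [hne]
  rfl

end Psi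

/-! ### Membership in #P -/

theorem card_elem (I : Input) : Fintype.card I.Elem = I.n := Fintype.card_fin I.n

theorem zeta_input_eq_card (I : Input) :
    zeta I.Elem I.t = (Nat.card {q : (Fin I.n → Fin I.t) × (Fin I.n → Fin I.n) //
      I.Good q.1 q.2} : ℤ) := by
  rw [zeta_eq_card_inversions]
  congr 1
  refine Nat.card_congr (Equiv.ofBijective (fun q => ⟨(q.1.1, fun i => finCongr (card_elem I) (q.1.2 i)),
    fun i j h => q.1.1.monotone (show (_ : I.Elem) ≤ _ from Or.inr h),
    (finCongr (card_elem I)).injective.comp q.1.2.injective, ?_⟩) ⟨?_, ?_⟩)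
  · obtain ⟨x, y, hxy, h₁, h₂⟩ := q.2
    exact ⟨x, y, hxy, h₁, h₂⟩
  · rintro ⟨⟨g, s⟩, h⟩ ⟨⟨g', s'⟩, h'⟩ heq
    have heq' := congrArg Subtype.val heq
    refine Subtype.ext (Prod.ext (DFunLike.coe_injective (congrArg Prod.fst heq'))
      (Equiv.ext fun i => ?_))
    exact (finCongr (card_elem I)).injective (congrFun (congrArg Prod.snd heq') i)
  · rintro ⟨⟨v, s⟩, h₁, h₂, i, j, h₃, h₄, h₅⟩
    let g : I.Elem →o Fin I.t := ⟨v, by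
      rintro i j (rfl | h)
      · exact le_rfl
      · exact h₁ i j h⟩
    -- An injective map of a finite set to itself is bijective, so the verifier only has to test
    -- injectivity.
    let s' : I.Elem ≃ Fin (Fintype.card I.Elem) :=
      (Equiv.ofBijective s (Finite.injective_iff_bijective.1 h₂)).trans (finCongr (card_elem I)).symm
    refine ⟨⟨(g, s'), i, j, h₃, h₄, h₅⟩, ?_⟩
    exact Subtype.ext (Prod.ext rfl rfl)

open Classical in
/-- The relation between inputs and certificates. -/
noncomputable def certifies (I : Input) (y : List Bool) : Bool :=
  decide (∃ v s, y = encodeCert I v s ∧ I.Good v s)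

theorem certifies_iff (I : Input) (y : List Bool) :
    certifies I y = true ↔ ∃ v s, y = encodeCert I v s ∧ I.Good v s := by
  simp [certifies]

theorem card_certificates (I : Input) :
    Nat.card {y : List Bool // certifies I y = true} =
      Nat.card {q : (Fin I.n → Fin I.t) × (Fin I.n → Fin I.n) // I.Good q.1 q.2} := by
  symm
  refine Nat.card_congr (Equiv.ofBijective
    (fun q => ⟨encodeCert I q.1.1 q.1.2, (certifies_iff I _).2 ⟨_, _, rfl, q.2⟩⟩) ⟨?_, ?_⟩)
  · rintro ⟨⟨v, s⟩, h⟩ ⟨⟨v', s'⟩, h'⟩ heq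
    obtain ⟨rfl, rfl⟩ := encodeCert_injective I (congrArg Subtype.val heq)
    rfl
  · rintro ⟨y, hy⟩
    obtain ⟨v, s, rfl, h⟩ := (certifies_iff I _).1 hy
    exact ⟨⟨(v, s), h⟩, rfl⟩

theorem certifies_computable :
    Nonempty (Turing.TM2ComputableInPolyTime (encodePair (Δ := Bool) Input.encode)
      Computability.encodeBool fun q => certifies q.1 q.2) := by
  refine computable_of_run _ _ verifier .inp (.ofFlags .init) (fun v => !v.f.bad && v.f.found)
    (100 * (Polynomial.X + 1) ^ 3) ?_
  rintro ⟨I, y⟩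
  obtain ⟨s, hrun, hs⟩ := run_verifier I y
  refine ⟨s, by simpa using hrun, ?_⟩
  rw [hs, Bool.eq_iff_iff, certifies_iff, ← finalFlags_iff]
  simp

theorem zeta_inSharpP : InSharpP Input.encode fun I : Input => zeta I.Elem I.t := by
  refine ⟨Bool, inferInstance, certifies, Polynomial.X * Polynomial.X, certifies_computable,
    fun I y hy => ?_, fun I => ?_⟩
  · obtain ⟨v, s, rfl, -⟩ := (certifies_iff I _).1 hy
    rw [length_encodeCert, length_ref, length_encode]
    rw [Polynomial.eval_mul, Polynomial.eval_X]
    -- A certificate has `n` records of length `|t| + n`, where `|t|` is the number of digits. Both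
    -- factors are at most the length `n (n + 1) + |t|` of the input.
    exact Nat.mul_le_mul (by nlinarith) (by nlinarith)
  · rw [card_certificates]
    exact zeta_input_eq_card I

end OrderPoly

theorem theoremt :
    OrderPoly.InSharpP OrderPoly.Input.encode
      (fun I : OrderPoly.Input => OrderPoly.zeta I.Elem I.t) ∧
    ∀ (X : Type*) [Fintype X] [PartialOrder X] (ℓ : X ≃ Fin (Fintype.card X))
      (_hℓ : StrictMono ℓ) (t : ℕ),
      Function.Injective (OrderPoly.psi (t := t) ℓ) ∧
      (∀ (f : OrderPoly.LinExt X) (β : Fin (Fintype.card X) → Fin t)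
        (g : X →o Fin t) (σ : Equiv.Perm (Fin (Fintype.card X))),
        OrderPoly.psi ℓ (f, β) = (g, σ) ↔
          OrderPoly.psiInvMap ℓ g σ = f.1 ∧ OrderPoly.psiInvPart ℓ g σ = β) ∧
      OrderPoly.zeta X t =
        (Nat.card {q : (X →o Fin t) × Equiv.Perm (Fin (Fintype.card X)) //
          ¬ StrictMono (OrderPoly.psiInvMap ℓ q.1 q.2)} : ℤ) := by
  exact ⟨OrderPoly.zeta_inSharpP, fun X _ _ ℓ _ t => ⟨OrderPoly.psi_injective ℓ,
    OrderPoly.psi_eq_iff ℓ, OrderPoly.zeta_eq_card ℓ⟩⟩
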